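/- Let $M$ be a smooth $2$-dimensional manifold and let $F:TM\to\mathbb{R}$ be a smooth Finsler structure on $M$: $F$ is $C^\infty$ and strictly positive on the slit tangent bundle $\mathcal{T}M=TM\setminus\{0\}$, vanishes on zero vectors, is positively homogeneous of degree $1$ on each tangent space, and the matrix $g_{ij}=\frac12\frac{\partial^2F^2}{\partial y^i\partial y^j}$ is nonsingular at every point of $\mathcal{T}M$. (Here $(x^i,y^i)$ are the coordinates of $TM$ induced by a chart of $M$, and repeated indices are summed.) Let $S=y^i\frac{\partial}{\partial x^i}-2G^i\frac{\partial}{\partial y^i}$, with $G^i=\frac14 g^{il}\left(y^k\frac{\partial^2F^2}{\partial x^k\partial y^l}-\frac{\partial F^2}{\partial x^l}\right)$, be the geodesic spray of $F$. Put $G^i_j=\frac{\partial G^i}{\partial y^j}$ and $R^i_j=2\frac{\partial G^i}{\partial x^j}-S(G^i_j)-G^i_kG^k_j$; let $\rho=R^i_i$ be the Ricci scalar and $K=\rho/F^2$ the flag curvature. Let $H$ be the vector field of the Berwald frame, that is, $H=h^j\left(\frac{\partial}{\partial x^j}-G^i_j\frac{\partial}{\partial y^i}\right)$ such that the vertical vector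 field $V=JH=h^i\frac{\partial}{\partial y^i}$ satisfies $V(F)=0$ and $g_{ij}h^ih^j=F^2$; these conditions determine $H$ up to sign. Let $\mathcal{I}=\frac{1}{4F^2}\frac{\partial^3F^2}{\partial y^i\partial y^j\partial y^k}h^ih^jh^k$ be the main (Cartan) scalar. (Replacing $H$ by $-H$ changes the signs of both $V$ and $\mathcal{I}$, so the condition $V(\rho)=-\mathcal{I}\rho$ does not depend on the choice of sign.) Assume that $S$ is nonflat, i.e. $\rho\neq0$ at every point of $\mathcal{T}M$. Then: 1. $V(\rho)=-\mathcal{I}\rho$ holds on $\mathcal{T}M$ if and only if $V(K)=-\mathcal{I}K$ holds on $\mathcal{T}M$; 2. $S(\rho)=0$ on $\mathcal{T}M$ if and only if $S(K)=0$ on $\mathcal{T}M$, i.e. the flag curvature is a first integral of the geodesic flow; 3. if $V(\rho)=-\mathcal{I}\rho$ and $S(\rho)=0$ on $\mathcal{T}M$, then $F$ is Riemannian: there is a smooth Riemannian metric $\mathsf{g}$ on $M$ with $F(v)^2=\mathsf{g}(v,v)$ for all $v\in TM$. -/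

import Mathlib

open scoped Manifold ContDiff Bundle

noncomputable section

/-- The model plane `ℝ²`. -/
abbrev Plane : Type := EuclideanSpace ℝ (Fin 2)

/-! ### Finsler geometry in the induced coordinates `(x, y)` of a chart

Points of `Plane × Plane` are pairs `p = (x, y)`, where `y` is the coordinate expression of a tangent
vector at the point with coordinates `x`. Tangent vectors at `p` are pairs `u = (u.1, u.2)`, standing
for `u.1^i ∂/∂x^i + u.2^i ∂/∂y^i`. The letter `L` denotes the coordinate expression of a Finsler
function. A vector `u` acts on a function `f` at `p` by `fderiv ℝ f p u`. -/
namespace Finsler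

/-- `∂f/∂x^i`. -/
def dx (i : Fin 2) (f : Plane × Plane → ℝ) (p : Plane × Plane) : ℝ :=
  fderiv ℝ f p (EuclideanSpace.single i 1, 0)

/-- `∂f/∂y^i`. -/
def dy (i : Fin 2) (f : Plane × Plane → ℝ) (p : Plane × Plane) : ℝ :=
  fderiv ℝ f p (0, EuclideanSpace.single i 1)

/-- The almost-tangent structure `J = ∂/∂y^i ⊗ dx^i`. -/
def almostTangent (u : Plane × Plane) : Plane × Plane := (0, u.1)

/-- The metric tensor `g_ij = (1/2) ∂²F²/∂y^i∂y^j`. -/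
def metric (L : Plane × Plane → ℝ) (p : Plane × Plane) : Matrix (Fin 2) (Fin 2) ℝ :=
  Matrix.of fun i j => (1 / 2) * dy i (dy j (fun q => L q ^ 2)) p

/-- The Cartan tensor `C_ijk = (1/2) ∂g_ij/∂y^k = (1/4) ∂³F²/∂y^i∂y^j∂y^k`. -/
def cartan (L : Plane × Plane → ℝ) (p : Plane × Plane) (i j k : Fin 2) : ℝ :=
  (1 / 2) * dy k (fun q => metric L q i j) p

/-- The coefficients of the geodesic spray,
`G^i = (1/4) g^{il} (y^k ∂²F²/∂x^k∂y^l - ∂F²/∂x^l)`. -/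
def sprayCoeff (L : Plane × Plane → ℝ) (i : Fin 2) (p : Plane × Plane) : ℝ :=
  (1 / 4) * ∑ l, (metric L p)⁻¹ i l *
    ((∑ k, p.2 k * dx k (dy l (fun q => L q ^ 2)) p) - dx l (fun q => L q ^ 2) p)

/-- The geodesic spray `S = y^i ∂/∂x^i - 2 G^i ∂/∂y^i`. -/
def spray (L : Plane × Plane → ℝ) (p : Plane × Plane) : Plane × Plane :=
  (p.2, WithLp.toLp 2 fun i => -2 * sprayCoeff L i p)

/-- The coefficients `G^i_j = ∂G^i/∂y^j` of the canonical nonlinear connection. -/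
def connCoeff (L : Plane × Plane → ℝ) (i j : Fin 2) (p : Plane × Plane) : ℝ :=
  dy j (sprayCoeff L i) p

/-- A tangent vector is horizontal if it is a combination of the
`δ/δx^j = ∂/∂x^j - G^i_j ∂/∂y^i`. -/
def IsHorizontal (L : Plane × Plane → ℝ) (p u : Plane × Plane) : Prop :=
  ∀ i, u.2 i = -∑ j, connCoeff L i j p * u.1 j

/-- The Jacobi endomorphism
`R^i_j = 2 ∂G^i/∂x^j - S(G^i_j) - G^i_k G^k_j`. -/
def jacobiEndo (L : Plane × Plane → ℝ) (p : Plane × Plane) : Matrix (Fin 2) (Fin 2) ℝ :=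
  Matrix.of fun i j => 2 * dx j (sprayCoeff L i) p
    - fderiv ℝ (connCoeff L i j) p (spray L p) - ∑ k, connCoeff L i k p * connCoeff L k j p

/-- The Ricci scalar `ρ`, the trace of the Jacobi endomorphism. -/
def ricciScalar (L : Plane × Plane → ℝ) (p : Plane × Plane) : ℝ := (jacobiEndo L p).trace

/-- The flag curvature `K`, determined by `ρ = K F²`. -/
def flagCurvature (L : Plane × Plane → ℝ) (p : Plane × Plane) : ℝ := ricciScalar L p / L p ^ 2

/-- `H` is a value at `p` of the horizontal vector field of a Berwald frame: it is horizontal,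
`d_J F (H) = V(F) = 0`, and `g(V, V) = F²`, where `V = J H`. Since the plane orthogonal to the
Liouville vector is a line, these conditions determine `H` at `p` up to sign. -/
structure IsBerwaldVector (L : Plane × Plane → ℝ) (p H : Plane × Plane) : Prop where
  horizontal : IsHorizontal L p H
  vertical_deriv : fderiv ℝ L p (almostTangent H) = 0
  normalized : ∑ i, ∑ j, metric L p i j * H.1 i * H.1 j = L p ^ 2

/-- The main (Cartan) scalar `𝓘 = C(V, V, V) / F²` with respect to `V = J H`; in terms of the
`g`-unit vector `m = V / F` it is given by `F C_ijk = 𝓘 m_i m_j m_k`. -/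
def mainScalar (L : Plane × Plane → ℝ) (p H : Plane × Plane) : ℝ :=
  (∑ i, ∑ j, ∑ k, cartan L p i j k * H.1 i * H.1 j * H.1 k) / L p ^ 2

end Finsler

/-! ### Finsler surfaces -/

section Surface

variable (M : Type*) [TopologicalSpace M] [ChartedSpace Plane M] [IsManifold (𝓡 2) ∞ M]

variable {M} in
/-- The coordinate expression of a function on `TM` in the coordinates `(x, y)` of `TM` induced by a
chart `e` of `M`: its value at `(x, y)` is the value of `F` at the image of `y ∈ T_xℝ²` under the
differential of `e⁻¹`. -/
def coordExpr (F : TangentBundle (𝓡 2) M → ℝ) (e : OpenPartialHomeomorph M Plane)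
    (p : Plane × Plane) : ℝ :=
  F (tangentMap 𝓘(ℝ, Plane) (𝓡 2) e.symm ⟨p.1, p.2⟩)

variable {M} in
/-- The coordinates of the nonzero tangent vectors over the domain of a chart. -/
def slitCoords (e : OpenPartialHomeomorph M Plane) : Set (Plane × Plane) :=
  {p | p.1 ∈ e.target ∧ p.2 ≠ 0}

/-- A smooth Finsler structure on the surface `M`. -/
structure FinslerSurface where
  /-- The Finsler function. -/
  F : TangentBundle (𝓡 2) M → ℝ
  smooth : ContMDiffOn (𝓡 2).tangent 𝓘(ℝ, ℝ) ∞ F {v | v.2 ≠ 0}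
  pos : ∀ (x : M) (v : TangentSpace (𝓡 2) x), v ≠ 0 → 0 < F ⟨x, v⟩
  zero : ∀ x : M, F ⟨x, 0⟩ = 0
  homogeneous : ∀ (x : M) (v : TangentSpace (𝓡 2) x) (t : ℝ), 0 < t → F ⟨x, t • v⟩ = t * F ⟨x, v⟩
  nondegenerate : ∀ e ∈ atlas Plane M, ∀ p ∈ slitCoords e,
    (Finsler.metric (coordExpr F e) p).det ≠ 0

namespace FinslerSurface

variable {M} (Φ : FinslerSurface M)

/-- The geodesic spray is nonflat: `ρ` vanishes at no nonzero tangent vector. -/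
def IsNonflat : Prop :=
  ∀ e ∈ atlas Plane M, ∀ p ∈ slitCoords e, Finsler.ricciScalar (coordExpr Φ.F e) p ≠ 0

/-- `V(κ) = -𝓘 κ` at all nonzero tangent vectors, where `κ` is an invariant of Finsler structures
such as `ρ` or `K`. Replacing `H` by `-H` changes the sign of both sides. -/
def VerticalCondition (κ : (Plane × Plane → ℝ) → Plane × Plane → ℝ) : Prop :=
  ∀ e ∈ atlas Plane M, ∀ p ∈ slitCoords e, ∀ H, Finsler.IsBerwaldVector (coordExpr Φ.F e) p H →
    fderiv ℝ (κ (coordExpr Φ.F e)) p (Finsler.almostTangent H) =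
      -Finsler.mainScalar (coordExpr Φ.F e) p H * κ (coordExpr Φ.F e) p

/-- `κ` is a first integral of the geodesic flow: `S(κ) = 0`. -/
def IsFirstIntegral (κ : (Plane × Plane → ℝ) → Plane × Plane → ℝ) : Prop :=
  ∀ e ∈ atlas Plane M, ∀ p ∈ slitCoords e,
    fderiv ℝ (κ (coordExpr Φ.F e)) p (Finsler.spray (coordExpr Φ.F e) p) = 0

/-- The Finsler structure is Riemannian: `F(v)² = g(v, v)` for a smooth Riemannian metric `g`. -/
def IsRiemannian : Prop :=
  ∃ g : Bundle.ContMDiffRiemannianMetric (𝓡 2) ∞ Plane (fun x : M => TangentSpace (𝓡 2) x),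
    ∀ (x : M) (v : TangentSpace (𝓡 2) x), Φ.F ⟨x, v⟩ ^ 2 = g.inner x v v

end FinslerSurface

end Surface

end

/-! The Berwald frame satisfies [S,V] = -H, [S,H] = ρV and [H,V] = S + 𝓘H + aV for some function a.
Its Jacobi identity forces a = S(𝓘) and the Bianchi identity V(ρ) + 𝓘ρ + S(S(𝓘)) = 0. If S(ρ) = 0
and V(ρ) = -𝓘ρ, then S(S(𝓘)) = 0, while [S,V] and [S,H] applied to ρ give H(ρ) = S(𝓘)ρ and S(S(𝓘))ρ
= -𝓘ρ². Hence 𝓘ρ² = 0 (`BerwaldRelations.mul_sq_eq_zero`), so 𝓘 = 0 by nonflatness.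

In dimension two 𝓘 determines the Cartan tensor, so g_ij does not depend on y along the connected
slit tangent planes, and F² = g_ij y^i y^j is a quadratic form in y. Polarization makes the form
independent of the chart (`HasVanishingCartanTensor.isRiemannian`).

The commutation relations are purely algebraic consequences of the homogeneity of F² and the
geodesic equation (`FinslerAlgebra.berwaldRelations`), and `IsFinslerOn.algebra` applies them to the
smooth functions over a chart. The smooth field h required there exists because det g > 0, which
follows from nondegeneracy and the positivity of F (`metric_det_pos`).

The equivalences for ρ and K = ρ/F² only need V(F) = 0 and S(F) = 0 (`fderiv_flagCurvature`). -/

/-! ### Consequences of the commutation relations of the Berwald frame. -/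

/-- Three derivations `S, H, V` with the commutation relations of the Berwald frame of a
two-dimensional spray with Ricci scalar `ρ` and main scalar `I`. -/
structure BerwaldRelations {A : Type*} [CommRing A] [Algebra ℝ A] (S H V : Derivation ℝ A A)
    (ρ I : A) : Prop where
  spray_vertical : ∀ f, S (V f) - V (S f) = -H f
  spray_horizontal : ∀ f, S (H f) - H (S f) = ρ * V f
  horizontal_vertical : ∃ a, ∀ f, H (V f) - V (H f) = S f + I * H f + a * V f
  independent : ∀ a b : A, (∀ f, a * H f + b * V f = 0) → a = 0 ∧ b = 0

namespace BerwaldRelations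

variable {A : Type*} [CommRing A] [Algebra ℝ A] {S H V : Derivation ℝ A A} {ρ I : A}

/-- The Bianchi identity, a consequence of the Jacobi identity for the frame. -/
theorem bianchi (h : BerwaldRelations S H V ρ I) : V ρ + I * ρ + S (S I) = 0 := by
  obtain ⟨a, ha⟩ := h.horizontal_vertical
  -- This is the Jacobi identity of S, H, V expanded by the three relations; the terms in S f
  -- cancel. The coefficient of H f gives a = S I, and substituting this in the coefficient of V f
  -- gives the claim.
  have key : ∀ f, (S I - a) * H f + (V ρ + I * ρ + S a) * V f = 0 := by
    intro f
    have h1 := congrArg S (ha f)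
    have h2 := congrArg H (h.spray_vertical f)
    have h3 := congrArg V (h.spray_horizontal f)
    have h4 := h.spray_horizontal (V f)
    have h5 := h.spray_vertical (H f)
    have h6 := ha (S f)
    simp only [map_sub, map_add, map_neg, Derivation.leibniz, smul_eq_mul] at h1 h2 h3
    linear_combination h4 + h2 - h5 - h3 - h1 + h6 - I * h.spray_horizontal f
      - a * h.spray_vertical f
  obtain ⟨h1, h2⟩ := h.independent _ _ key
  rw [sub_eq_zero] at h1
  rw [h1, h2]

/-- The commutator [S,V] applied to ρ computes H ρ = S(I) ρ; then [S,H] applied to ρ reads S(S I) ρ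
= -I ρ², and the Bianchi identity reduces to S(S I) = 0. -/
theorem mul_sq_eq_zero (h : BerwaldRelations S H V ρ I) (hS : S ρ = 0) (hV : V ρ = -I * ρ) :
    I * ρ ^ 2 = 0 := by
  have hH : H ρ = S I * ρ := by
    have := h.spray_vertical ρ
    rw [hS, hV] at this
    simp only [map_zero, neg_mul, map_neg, Derivation.leibniz, smul_eq_mul, hS] at this
    linear_combination this
  have h2 := h.spray_horizontal ρ
  rw [hS, hV, hH] at h2
  simp only [map_zero, Derivation.leibniz, smul_eq_mul, hS] at h2
  have h3 := h.bianchi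
  linear_combination h2 - ρ * h3 + ρ * hV

end BerwaldRelations

/-! ### Finsler calculus over a commutative ring: the orthogonal frame. -/

/-- The differential algebra of a Finsler function over the coordinate ring `A` of (an open part
of) a slit tangent bundle: `x, y` are the coordinates, `X, Y` the coordinate derivations, `E` is the
square of the Finsler function, `G` the coefficients of the geodesic spray and `h` the components
of a vector field of length `√E` orthogonal to the Liouville vector field. -/
structure FinslerAlgebra (A : Type*) [CommRing A] [Algebra ℝ A] where
  X : Fin 2 → Derivation ℝ A A
  Y : Fin 2 → Derivation ℝ A A
  x : Fin 2 → A
  y : Fin 2 → A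
  X_comm_Y : ∀ i j f, Y j (X i f) = X i (Y j f)
  X_comm : ∀ i j f, X i (X j f) = X j (X i f)
  Y_comm : ∀ i j f, Y i (Y j f) = Y j (Y i f)
  X_x : ∀ i j, X i (x j) = if i = j then 1 else 0
  Y_x : ∀ i j, Y i (x j) = 0
  X_y : ∀ i j, X i (y j) = 0
  Y_y : ∀ i j, Y i (y j) = if i = j then 1 else 0
  E : A
  Einv : A
  E_inv : E * Einv = 1
  euler : ∑ i, y i * Y i E = 2 * E
  G : Fin 2 → A
  -- The second derivatives of `E` are 2 g_kl, which turns the usual factor 4 into 2, here and in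
  -- the normalization of `h`.
  geodesic : ∀ l, ∑ k, y k * X k (Y l E) - X l E = 2 * ∑ k, G k * Y k (Y l E)
  h : Fin 2 → A
  h_orthogonal : ∑ i, h i * Y i E = 0
  h_normalized : ∑ i, ∑ j, Y i (Y j E) * h i * h j = 2 * E

namespace FinslerAlgebra

variable {A : Type*} [CommRing A] [Algebra ℝ A] (𝔽 : FinslerAlgebra A)

def spray : Derivation ℝ A A := ∑ k, 𝔽.y k • 𝔽.X k - ∑ k, (2 * 𝔽.G k) • 𝔽.Y k

/-- The derivation `δ/δx^j`. -/
def δ (j : Fin 2) : Derivation ℝ A A := 𝔽.X j - ∑ i, 𝔽.Y j (𝔽.G i) • 𝔽.Y i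

def horizontal : Derivation ℝ A A := ∑ j, 𝔽.h j • 𝔽.δ j

def vertical : Derivation ℝ A A := ∑ j, 𝔽.h j • 𝔽.Y j

def jacobi (i j : Fin 2) : A :=
  2 * 𝔽.X j (𝔽.G i) - 𝔽.spray (𝔽.Y j (𝔽.G i)) - ∑ k, 𝔽.Y k (𝔽.G i) * 𝔽.Y j (𝔽.G k)

def ricci : A := ∑ i, 𝔽.jacobi i i

noncomputable def mainScalar : A :=
  𝔽.Einv * algebraMap ℝ A (1 / 4) *
    ∑ i, ∑ j, ∑ k, 𝔽.Y k (𝔽.Y i (𝔽.Y j 𝔽.E)) * 𝔽.h i * 𝔽.h j * 𝔽.h k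

theorem spray_apply (f : A) : 𝔽.spray f = 𝔽.y 0 * 𝔽.X 0 f + 𝔽.y 1 * 𝔽.X 1 f
    - (2 * 𝔽.G 0 * 𝔽.Y 0 f + 2 * 𝔽.G 1 * 𝔽.Y 1 f) := by
  simp [spray, Fin.sum_univ_two]

theorem δ_apply (j : Fin 2) (f : A) : 𝔽.δ j f =
    𝔽.X j f - (𝔽.Y j (𝔽.G 0) * 𝔽.Y 0 f + 𝔽.Y j (𝔽.G 1) * 𝔽.Y 1 f) := by
  simp [δ, Fin.sum_univ_two]

theorem horizontal_apply (f : A) :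
    𝔽.horizontal f = 𝔽.h 0 * 𝔽.δ 0 f + 𝔽.h 1 * 𝔽.δ 1 f := by
  simp [horizontal, Fin.sum_univ_two]

theorem vertical_apply (f : A) : 𝔽.vertical f = 𝔽.h 0 * 𝔽.Y 0 f + 𝔽.h 1 * 𝔽.Y 1 f := by
  simp [vertical, Fin.sum_univ_two]

theorem algebraMap_inv_mul (n : ℕ) [n.AtLeastTwo] :
    algebraMap ℝ A (1 / (ofNat(n) : ℝ)) * (ofNat(n) : A) = 1 := by
  rw [← map_ofNat (algebraMap ℝ A) n, ← map_mul, one_div_mul_cancel, map_one]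
  exact OfNat.ofNat_ne_zero n

/-- The ring may have zero divisors, so factors 2 and `E` are cancelled by means of their explicit
inverses. -/
theorem two_mul_cancel {a b : A} (h : 2 * a = 2 * b) : a = b := by
  linear_combination algebraMap ℝ A (1 / 2) * h - (a - b) * algebraMap_inv_mul (A := A) 2

theorem E_cancel {a b : A} (h : 𝔽.E * a = 𝔽.E * b) : a = b := by
  linear_combination 𝔽.Einv * h - (a - b) * 𝔽.E_inv

theorem mainScalar_mul :
    4 * 𝔽.E * 𝔽.mainScalar =
      ∑ i, ∑ j, ∑ k, 𝔽.Y k (𝔽.Y i (𝔽.Y j 𝔽.E)) * 𝔽.h i * 𝔽.h j * 𝔽.h k := by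
  rw [mainScalar]
  generalize ∑ i, ∑ j, ∑ k, 𝔽.Y k (𝔽.Y i (𝔽.Y j 𝔽.E)) * 𝔽.h i * 𝔽.h j * 𝔽.h k = T
  linear_combination T * algebraMap_inv_mul (A := A) 4
    + T * algebraMap ℝ A (1 / 4) * 4 * 𝔽.E_inv

theorem derivation_ofNat (D : Derivation ℝ A A) (n : ℕ) [n.AtLeastTwo] : D (ofNat(n) : A) = 0 := by
  rw [← map_ofNat (algebraMap ℝ A) n, D.map_algebraMap]

/-- The derivative of Euler's identity in y^j: the first derivatives of `E` are homogeneous of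
degree 1. -/
theorem y_metric (j : Fin 2) :
    𝔽.y 0 * 𝔽.Y 0 (𝔽.Y j 𝔽.E) + 𝔽.y 1 * 𝔽.Y 1 (𝔽.Y j 𝔽.E) = 𝔽.Y j 𝔽.E := by
  have h := congrArg (𝔽.Y j) 𝔽.euler
  have c := 𝔽.Y_comm 0 1 𝔽.E
  fin_cases j
  · simp [Fin.sum_univ_two, 𝔽.Y_y, derivation_ofNat] at h ⊢
    linear_combination h - 𝔽.y 1 * c
  · simp [Fin.sum_univ_two, 𝔽.Y_y, derivation_ofNat] at h ⊢
    linear_combination h + 𝔽.y 0 * c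

/-- The decomposition of the identity in the orthogonal frame `y, h`. -/
theorem frame_identity (i j : Fin 2) :
    𝔽.y i * 𝔽.Y j 𝔽.E
      + 𝔽.h i * (𝔽.h 0 * 𝔽.Y 0 (𝔽.Y j 𝔽.E) + 𝔽.h 1 * 𝔽.Y 1 (𝔽.Y j 𝔽.E)) =
      if i = j then 2 * 𝔽.E else 0 := by
  have e := 𝔽.euler
  have o := 𝔽.h_orthogonal
  have n := 𝔽.h_normalized
  have y0 := 𝔽.y_metric 0
  have y1 := 𝔽.y_metric 1
  simp only [Fin.sum_univ_two] at e o n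
  have yc := 𝔽.Y_comm 0 1 𝔽.E
  set c := algebraMap ℝ A (1 / 2) * 𝔽.Einv
  have hc : c * (2 * 𝔽.E) = 1 := by
    linear_combination algebraMap_inv_mul (A := A) 2 * (𝔽.E * 𝔽.Einv) + 𝔽.E_inv
  obtain ⟨q, hq⟩ : ∃ q : Fin 2 → A,
      ∀ j, 𝔽.h 0 * 𝔽.Y 0 (𝔽.Y j 𝔽.E) + 𝔽.h 1 * 𝔽.Y 1 (𝔽.Y j 𝔽.E) = q j := ⟨_, fun _ => rfl⟩
  have h00 : 𝔽.y 0 * (c * 𝔽.Y 0 𝔽.E) + 𝔽.y 1 * (c * 𝔽.Y 1 𝔽.E) = 1 := by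
    linear_combination c * e + hc
  have h01 : 𝔽.y 0 * (c * q 0) + 𝔽.y 1 * (c * q 1) = 0 := by
    rw [← hq, ← hq]
    linear_combination c * o + c * 𝔽.h 0 * y0 + c * 𝔽.h 1 * y1
      + c * (𝔽.y 1 * 𝔽.h 0 - 𝔽.y 0 * 𝔽.h 1) * yc
  have h10 : 𝔽.h 0 * (c * 𝔽.Y 0 𝔽.E) + 𝔽.h 1 * (c * 𝔽.Y 1 𝔽.E) = 0 := by
    linear_combination c * o
  have h11 : 𝔽.h 0 * (c * q 0) + 𝔽.h 1 * (c * q 1) = 1 := by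
    rw [← hq, ← hq]
    linear_combination c * n + hc
  -- The rows y, h are dual to the columns dE/(2E), q/(2E). A one-sided inverse of a square matrix
  -- over a commutative ring is two-sided, and the product in the other order is the required
  -- decomposition.
  have hPB : !![𝔽.y 0, 𝔽.y 1; 𝔽.h 0, 𝔽.h 1] *
      !![c * 𝔽.Y 0 𝔽.E, c * q 0; c * 𝔽.Y 1 𝔽.E, c * q 1] = 1 := by
    rw [Matrix.mul_fin_two, Matrix.one_fin_two, h00, h01, h10, h11]
  have hBP := congrArg (fun B => B j i) (mul_eq_one_comm.1 hPB)
  rw [Matrix.mul_fin_two] at hBP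
  rw [hq]
  have hc' : ∀ a b : A, c * a = b → a = 2 * 𝔽.E * b := fun a b h => by
    linear_combination 2 * 𝔽.E * h - a * hc
  have : c * (𝔽.y i * 𝔽.Y j 𝔽.E + 𝔽.h i * q j) = (1 : Matrix (Fin 2) (Fin 2) A) j i := by
    rw [← hBP]
    fin_cases i <;> fin_cases j <;> simp <;> ring
  rw [hc' _ _ this, Matrix.one_apply]
  simp [eq_comm]

/-- A vector orthogonal to both y and h is zero; dE(W) is the pairing of W with y. Vector identities
below are proved by checking these two components. -/
theorem frame_zero (W : Fin 2 → A) (h₁ : W 0 * 𝔽.Y 0 𝔽.E + W 1 * 𝔽.Y 1 𝔽.E = 0)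
    (h₂ : ∑ i, ∑ j, 𝔽.Y i (𝔽.Y j 𝔽.E) * 𝔽.h i * W j = 0) (i : Fin 2) : W i = 0 := by
  simp only [Fin.sum_univ_two] at h₂
  have f0 := 𝔽.frame_identity i 0
  have f1 := 𝔽.frame_identity i 1
  apply 𝔽.E_cancel
  apply two_mul_cancel
  have : (if i = 0 then 2 * 𝔽.E else 0) * W 0 + (if i = 1 then 2 * 𝔽.E else 0) * W 1
      = 2 * (𝔽.E * W i) := by
    fin_cases i <;> simp <;> ring
  rw [← this, ← f0, ← f1]
  linear_combination 𝔽.y i * h₁ + 𝔽.h i * h₂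

/-- A vertical vector annihilating `E` is proportional to `h`. -/
theorem frame_proportional (W : Fin 2 → A) (h₁ : W 0 * 𝔽.Y 0 𝔽.E + W 1 * 𝔽.Y 1 𝔽.E = 0) :
    ∃ a, ∀ i, W i = a * 𝔽.h i := by
  refine ⟨algebraMap ℝ A (1 / 2) * 𝔽.Einv *
    ∑ i, ∑ j, 𝔽.Y i (𝔽.Y j 𝔽.E) * 𝔽.h i * W j, fun i => ?_⟩
  simp only [Fin.sum_univ_two]
  have f0 := 𝔽.frame_identity i 0
  have f1 := 𝔽.frame_identity i 1
  apply 𝔽.E_cancel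
  apply two_mul_cancel
  have : (if i = 0 then 2 * 𝔽.E else 0) * W 0 + (if i = 1 then 2 * 𝔽.E else 0) * W 1
      = 2 * (𝔽.E * W i) := by
    fin_cases i <;> simp <;> ring
  rw [← this, ← f0, ← f1]
  set t := algebraMap ℝ A (1 / 2)
  have ht : t * 2 = 1 := algebraMap_inv_mul (A := A) 2
  have := 𝔽.E_inv
  have hE : 2 * (𝔽.E * (t * 𝔽.Einv)) = 1 := by
    linear_combination ht * (𝔽.E * 𝔽.Einv) + this
  linear_combination 𝔽.y i * h₁ - 𝔽.h i * hE * 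
    (𝔽.Y 0 (𝔽.Y 0 𝔽.E) * 𝔽.h 0 * W 0 + 𝔽.Y 0 (𝔽.Y 1 𝔽.E) * 𝔽.h 0 * W 1
    + (𝔽.Y 1 (𝔽.Y 0 𝔽.E) * 𝔽.h 1 * W 0 + 𝔽.Y 1 (𝔽.Y 1 𝔽.E) * 𝔽.h 1 * W 1))

/-- Nondegeneracy is not an axiom of the structure: it comes from the frame, by contracting the
hypothesis with y and with h. -/
theorem metric_nondegenerate (W : Fin 2 → A)
    (h : ∀ l, W 0 * 𝔽.Y 0 (𝔽.Y l 𝔽.E) + W 1 * 𝔽.Y 1 (𝔽.Y l 𝔽.E) = 0) (i : Fin 2) : W i = 0 := by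
  refine 𝔽.frame_zero W ?_ ?_ i
  · rw [← 𝔽.y_metric 0, ← 𝔽.y_metric 1]
    linear_combination 𝔽.y 0 * h 0 + 𝔽.y 1 * h 1
      + (W 0 * 𝔽.y 1 - W 1 * 𝔽.y 0) * (-𝔽.Y_comm 0 1 𝔽.E)
  · simp only [Fin.sum_univ_two]
    linear_combination 𝔽.h 0 * h 0 + 𝔽.h 1 * h 1
      + (𝔽.h 0 * W 1 - 𝔽.h 1 * W 0) * 𝔽.Y_comm 0 1 𝔽.E

/-! ### The geodesic spray and its nonlinear connection. -/

/-- The Euler–Lagrange equation of the energy. -/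
theorem spray_Y_E (l : Fin 2) : 𝔽.spray (𝔽.Y l 𝔽.E) = 𝔽.X l 𝔽.E := by
  have := 𝔽.geodesic l
  simp only [Fin.sum_univ_two] at this
  rw [spray_apply]
  linear_combination this

theorem spray_y (i : Fin 2) : 𝔽.spray (𝔽.y i) = -2 * 𝔽.G i := by
  rw [spray_apply]
  simp only [𝔽.X_y, 𝔽.Y_y]
  fin_cases i <;> simp

/-- Applying S to Euler's identity and using the Euler–Lagrange equation gives S(E) = 2 S(E). -/
theorem spray_E : 𝔽.spray 𝔽.E = 0 := by
  have h := congrArg 𝔽.spray 𝔽.euler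
  simp only [Fin.sum_univ_two, map_add, Derivation.leibniz, smul_eq_mul, spray_Y_E, spray_y,
    derivation_ofNat] at h
  have h2 := 𝔽.spray_apply 𝔽.E
  linear_combination -h2 - h

/-- Differentiating S(E) = 0 in y^j and inserting the Euler–Lagrange equation gives twice this
expression. -/
theorem δ_E (j : Fin 2) : 𝔽.δ j 𝔽.E = 0 := by
  have h := congrArg (𝔽.Y j) 𝔽.spray_E
  rw [spray_apply] at h
  have h2 := 𝔽.spray_Y_E j
  rw [spray_apply] at h2
  simp only [map_add, map_sub, map_zero, Derivation.leibniz, smul_eq_mul, derivation_ofNat, 𝔽.X_comm_Y,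
    𝔽.Y_y] at h
  rw [𝔽.Y_comm j 0, 𝔽.Y_comm j 1] at h
  apply two_mul_cancel
  rw [δ_apply]
  have h3 : (if j = 0 then 1 else 0) * 𝔽.X 0 𝔽.E + (if j = 1 then 1 else 0) * 𝔽.X 1 𝔽.E
      = 𝔽.X j 𝔽.E := by fin_cases j <;> simp
  linear_combination h - h2 - h3

/-- The metric tensor is parallel along the geodesic flow. The y^i-derivative of the Euler–Lagrange
equation contains a term antisymmetric in i, j, which disappears on adding the equation with i and j
exchanged. -/
theorem spray_metric (i j : Fin 2) :
    𝔽.spray (𝔽.Y i (𝔽.Y j 𝔽.E)) =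
      𝔽.Y i (𝔽.Y 0 𝔽.E) * 𝔽.Y j (𝔽.G 0) + 𝔽.Y i (𝔽.Y 1 𝔽.E) * 𝔽.Y j (𝔽.G 1) +
      (𝔽.Y j (𝔽.Y 0 𝔽.E) * 𝔽.Y i (𝔽.G 0) + 𝔽.Y j (𝔽.Y 1 𝔽.E) * 𝔽.Y i (𝔽.G 1)) := by
  have key : ∀ i j, 𝔽.spray (𝔽.Y i (𝔽.Y j 𝔽.E)) = 𝔽.X j (𝔽.Y i 𝔽.E) - 𝔽.X i (𝔽.Y j 𝔽.E)
      + 2 * (𝔽.Y j (𝔽.Y 0 𝔽.E) * 𝔽.Y i (𝔽.G 0) + 𝔽.Y j (𝔽.Y 1 𝔽.E) * 𝔽.Y i (𝔽.G 1)) := by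
    intro i j
    have h := congrArg (𝔽.Y i) (𝔽.spray_Y_E j)
    rw [spray_apply] at h ⊢
    simp only [map_add, map_sub, Derivation.leibniz, smul_eq_mul, derivation_ofNat, 𝔽.X_comm_Y,
      𝔽.Y_y] at h
    rw [𝔽.Y_comm i 0, 𝔽.Y_comm i 1, 𝔽.Y_comm 0 j, 𝔽.Y_comm 1 j] at h
    have h3 : (if i = 0 then 1 else 0) * 𝔽.X 0 (𝔽.Y j 𝔽.E)
        + (if i = 1 then 1 else 0) * 𝔽.X 1 (𝔽.Y j 𝔽.E)
        = 𝔽.X i (𝔽.Y j 𝔽.E) := by fin_cases i <;> simp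
    linear_combination h - h3
  apply two_mul_cancel
  have h1 := key i j
  have h2 := key j i
  rw [𝔽.Y_comm j i] at h2
  linear_combination h1 + h2

/-- Let C be the Liouville field. It commutes with the X_i and satisfies [C, Y_i] = -Y_i, so
applying C to the geodesic equation puts C(G) - 2G in the kernel of the metric. -/
theorem G_homogeneous (i : Fin 2) :
    𝔽.y 0 * 𝔽.Y 0 (𝔽.G i) + 𝔽.y 1 * 𝔽.Y 1 (𝔽.G i) = 2 * 𝔽.G i := by
  rw [← sub_eq_zero]
  refine 𝔽.metric_nondegenerate
    (fun i => 𝔽.y 0 * 𝔽.Y 0 (𝔽.G i) + 𝔽.y 1 * 𝔽.Y 1 (𝔽.G i) - 2 * 𝔽.G i) (fun l => ?_) i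
  set C : Derivation ℝ A A := 𝔽.y 0 • 𝔽.Y 0 + 𝔽.y 1 • 𝔽.Y 1 with hC
  have hCf : ∀ f, C f = 𝔽.y 0 * 𝔽.Y 0 f + 𝔽.y 1 * 𝔽.Y 1 f := fun f => by simp [hC]
  have hX : ∀ i f, C (𝔽.X i f) = 𝔽.X i (C f) := fun i f => by
    simp [hCf, 𝔽.X_comm_Y, 𝔽.X_y]
  have hY : ∀ i f, C (𝔽.Y i f) = 𝔽.Y i (C f) - 𝔽.Y i f := fun i f => by
    have h3 : (if i = 0 then 1 else 0) * 𝔽.Y 0 f + (if i = 1 then 1 else 0) * 𝔽.Y 1 f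
        = 𝔽.Y i f := by fin_cases i <;> simp
    simp only [hCf, 𝔽.Y_y, map_add, Derivation.leibniz, smul_eq_mul, 𝔽.Y_comm i]
    linear_combination -h3
  have hy : ∀ i, C (𝔽.y i) = 𝔽.y i := fun i => by
    simp only [hCf, 𝔽.Y_y]; fin_cases i <;> simp
  have hE : C 𝔽.E = 2 * 𝔽.E := by simpa [hCf, Fin.sum_univ_two] using 𝔽.euler
  have h := 𝔽.geodesic l
  have h' := congrArg C h
  simp only [Fin.sum_univ_two, map_add, map_sub, Derivation.leibniz, smul_eq_mul, derivation_ofNat,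
    map_zero, hX, hY, hy, hE] at h h'
  simp only [← hCf]
  apply two_mul_cancel
  linear_combination 2 * h - h'

theorem horizontal_E : 𝔽.horizontal 𝔽.E = 0 := by
  simp [horizontal_apply, δ_E]

theorem vertical_E : 𝔽.vertical 𝔽.E = 0 := by
  simpa [vertical_apply, Fin.sum_univ_two] using 𝔽.h_orthogonal

/-- The vector field `h` is parallel along the geodesic flow. -/
theorem spray_h (i : Fin 2) :
    𝔽.spray (𝔽.h i) = -(𝔽.h 0 * 𝔽.Y 0 (𝔽.G i) + 𝔽.h 1 * 𝔽.Y 1 (𝔽.G i)) := by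
  rw [← sub_eq_zero, sub_neg_eq_add]
  refine 𝔽.frame_zero
    (fun i => 𝔽.spray (𝔽.h i) + (𝔽.h 0 * 𝔽.Y 0 (𝔽.G i) + 𝔽.h 1 * 𝔽.Y 1 (𝔽.G i))) ?_ ?_ i
  -- The two components are the S-derivatives of orthogonality (with `δ_E`) and of normalization
  -- (with `spray_metric`).
  · have h := congrArg 𝔽.spray 𝔽.h_orthogonal
    simp only [Fin.sum_univ_two, map_add, Derivation.leibniz, smul_eq_mul, spray_Y_E,
      map_zero] at h
    have h0 := 𝔽.δ_E 0
    have h1 := 𝔽.δ_E 1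
    rw [δ_apply] at h0 h1
    linear_combination h - 𝔽.h 0 * h0 - 𝔽.h 1 * h1
  · have h := congrArg 𝔽.spray 𝔽.h_normalized
    simp only [Fin.sum_univ_two, map_add, Derivation.leibniz, smul_eq_mul, spray_metric,
      derivation_ofNat, spray_E] at h
    simp only [Fin.sum_univ_two]
    apply two_mul_cancel
    rw [𝔽.Y_comm 1 0] at h ⊢
    linear_combination h

/-! ### The commutators of the Berwald frame. -/

theorem spray_vertical_comm (f : A) :
    𝔽.spray (𝔽.vertical f) - 𝔽.vertical (𝔽.spray f) = -𝔽.horizontal f := by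
  rw [𝔽.vertical_apply f, 𝔽.vertical_apply (𝔽.spray f)]
  simp only [map_add, Derivation.leibniz, smul_eq_mul, spray_h]
  simp only [spray_apply, map_sub, map_add, Derivation.leibniz, smul_eq_mul, derivation_ofNat,
    𝔽.X_comm_Y, 𝔽.Y_y, horizontal_apply, δ_apply, 𝔽.Y_comm 1 0]
  simp
  ring

/-- The Jacobi endomorphism is the vertical part of [S, δ_j]. -/
theorem spray_δ_comm (j : Fin 2) (f : A) :
    𝔽.spray (𝔽.δ j f) - 𝔽.δ j (𝔽.spray f) =
      𝔽.Y j (𝔽.G 0) * 𝔽.δ 0 f + 𝔽.Y j (𝔽.G 1) * 𝔽.δ 1 f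
      + (𝔽.jacobi 0 j * 𝔽.Y 0 f + 𝔽.jacobi 1 j * 𝔽.Y 1 f) := by
  simp only [jacobi, Fin.sum_univ_two]
  simp only [δ_apply, map_sub, map_add, Derivation.leibniz, smul_eq_mul]
  simp only [spray_apply, map_sub, map_add, Derivation.leibniz, smul_eq_mul, derivation_ofNat,
    𝔽.X_comm_Y, 𝔽.X_y, 𝔽.Y_y, 𝔽.Y_comm 1 0]
  have e : ∀ i, 𝔽.X i (𝔽.X j f) = 𝔽.X j (𝔽.X i f) := fun i => 𝔽.X_comm i j f
  simp only [e]
  simp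
  ring

/-- The S-derivative of the homogeneity relation for `G`. -/
theorem jacobi_y (i : Fin 2) : 𝔽.jacobi i 0 * 𝔽.y 0 + 𝔽.jacobi i 1 * 𝔽.y 1 = 0 := by
  have h := congrArg 𝔽.spray (𝔽.G_homogeneous i)
  simp only [map_add, derivation_ofNat, Derivation.leibniz, smul_eq_mul, spray_y] at h
  have h2 := 𝔽.spray_apply (𝔽.G i)
  simp only [jacobi, Fin.sum_univ_two]
  linear_combination -2 * h2 - h - 𝔽.Y 0 (𝔽.G i) * 𝔽.G_homogeneous 0
    - 𝔽.Y 1 (𝔽.G i) * 𝔽.G_homogeneous 1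

theorem spray_horizontal_comm_jacobi (f : A) :
    𝔽.spray (𝔽.horizontal f) - 𝔽.horizontal (𝔽.spray f) =
      (𝔽.jacobi 0 0 * 𝔽.h 0 + 𝔽.jacobi 0 1 * 𝔽.h 1) * 𝔽.Y 0 f
      + (𝔽.jacobi 1 0 * 𝔽.h 0 + 𝔽.jacobi 1 1 * 𝔽.h 1) * 𝔽.Y 1 f := by
  rw [𝔽.horizontal_apply f, 𝔽.horizontal_apply (𝔽.spray f)]
  simp only [map_add, Derivation.leibniz, smul_eq_mul, spray_h]
  linear_combination 𝔽.h 0 * 𝔽.spray_δ_comm 0 f + 𝔽.h 1 * 𝔽.spray_δ_comm 1 f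

/-- Since S and H annihilate E, so does [S,H], whose components are R h; hence R h is a multiple of
h. As also R y = 0, the eigenvalue is the trace. -/
theorem jacobi_h (i : Fin 2) :
    𝔽.jacobi i 0 * 𝔽.h 0 + 𝔽.jacobi i 1 * 𝔽.h 1 = 𝔽.ricci * 𝔽.h i := by
  have hE := 𝔽.spray_horizontal_comm_jacobi 𝔽.E
  rw [horizontal_E, spray_E, map_zero, map_zero, sub_zero] at hE
  obtain ⟨a, ha⟩ := 𝔽.frame_proportional
    (fun i => 𝔽.jacobi i 0 * 𝔽.h 0 + 𝔽.jacobi i 1 * 𝔽.h 1) hE.symm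
  have hr : 𝔽.ricci = a := by
    apply 𝔽.E_cancel
    apply two_mul_cancel
    have f00 := 𝔽.frame_identity 0 0
    have f01 := 𝔽.frame_identity 0 1
    have f10 := 𝔽.frame_identity 1 0
    have f11 := 𝔽.frame_identity 1 1
    simp at f00 f01 f10 f11
    have n := 𝔽.h_normalized
    simp only [Fin.sum_univ_two, ricci] at n ⊢
    set q0 := 𝔽.h 0 * 𝔽.Y 0 (𝔽.Y 0 𝔽.E) + 𝔽.h 1 * 𝔽.Y 1 (𝔽.Y 0 𝔽.E) with hq0
    set q1 := 𝔽.h 0 * 𝔽.Y 0 (𝔽.Y 1 𝔽.E) + 𝔽.h 1 * 𝔽.Y 1 (𝔽.Y 1 𝔽.E) with hq1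
    have hq : q0 * 𝔽.h 0 + q1 * 𝔽.h 1 = 2 * 𝔽.E := by
      rw [hq0, hq1]; linear_combination n
    linear_combination a * hq + q0 * ha 0 + q1 * ha 1 - 𝔽.jacobi 0 0 * f00 - 𝔽.jacobi 1 1 * f11
      - 𝔽.jacobi 0 1 * f10 - 𝔽.jacobi 1 0 * f01 + 𝔽.Y 0 𝔽.E * 𝔽.jacobi_y 0
      + 𝔽.Y 1 𝔽.E * 𝔽.jacobi_y 1
  rw [hr]
  exact ha i

theorem spray_horizontal_comm (f : A) :
    𝔽.spray (𝔽.horizontal f) - 𝔽.horizontal (𝔽.spray f) = 𝔽.ricci * 𝔽.vertical f := by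
  rw [spray_horizontal_comm_jacobi, jacobi_h, jacobi_h, vertical_apply]
  ring

/-- The components along y and h come from applying V to orthogonality and to normalization; the
latter produces the third derivatives of E, hence the main scalar. -/
theorem vertical_h (i : Fin 2) : 𝔽.vertical (𝔽.h i) = -𝔽.y i - 𝔽.mainScalar * 𝔽.h i := by
  rw [← sub_eq_zero]
  refine 𝔽.frame_zero
    (fun i => 𝔽.vertical (𝔽.h i) - (-𝔽.y i - 𝔽.mainScalar * 𝔽.h i)) ?_ ?_ i
  · have h := congrArg 𝔽.vertical 𝔽.h_orthogonal
    have n := 𝔽.h_normalized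
    have e := 𝔽.euler
    have o := 𝔽.h_orthogonal
    simp only [Fin.sum_univ_two, map_add, Derivation.leibniz, smul_eq_mul, map_zero,
      𝔽.vertical_apply (𝔽.Y _ _)] at h n e o
    linear_combination h - n + e + 𝔽.mainScalar * o
  · have h := congrArg 𝔽.vertical 𝔽.h_normalized
    have n := 𝔽.h_normalized
    have o := 𝔽.h_orthogonal
    have m := 𝔽.mainScalar_mul
    have y0 := 𝔽.y_metric 0
    have y1 := 𝔽.y_metric 1
    simp only [Fin.sum_univ_two, map_add, Derivation.leibniz, smul_eq_mul, derivation_ofNat,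
      vertical_E, 𝔽.vertical_apply (𝔽.Y _ _)] at h n o m
    simp only [Fin.sum_univ_two]
    apply two_mul_cancel
    simp only [𝔽.Y_comm 1 0] at h n o m y0 y1 ⊢
    linear_combination h + 2 * 𝔽.mainScalar * n + m + 2 * o + 2 * 𝔽.h 0 * y0 + 2 * 𝔽.h 1 * y1

/-- After removing S and 𝓘H the bracket is vertical, and it annihilates E because S, H and V do, so
it is a multiple of V. The multiple need not be computed: the Jacobi identity determines it. -/
theorem horizontal_vertical_comm : ∃ a, ∀ f,
    𝔽.horizontal (𝔽.vertical f) - 𝔽.vertical (𝔽.horizontal f) =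
      𝔽.spray f + 𝔽.mainScalar * 𝔽.horizontal f + a * 𝔽.vertical f := by
  have key : ∃ W : Fin 2 → A, ∀ f,
      𝔽.horizontal (𝔽.vertical f) - 𝔽.vertical (𝔽.horizontal f) =
      𝔽.spray f + 𝔽.mainScalar * 𝔽.horizontal f + (W 0 * 𝔽.Y 0 f + W 1 * 𝔽.Y 1 f) := by
    refine ⟨fun i => 𝔽.horizontal (𝔽.h i) + ∑ j, ∑ k, 𝔽.h j * 𝔽.h k * 𝔽.Y k (𝔽.Y j (𝔽.G i)),
      fun f => ?_⟩
    have hS : 𝔽.spray f = 𝔽.y 0 * 𝔽.δ 0 f + 𝔽.y 1 * 𝔽.δ 1 f := by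
      rw [spray_apply, δ_apply, δ_apply]
      linear_combination 𝔽.Y 0 f * 𝔽.G_homogeneous 0 + 𝔽.Y 1 f * 𝔽.G_homogeneous 1
    rw [𝔽.vertical_apply f, 𝔽.horizontal_apply f, hS]
    simp only [map_add, Derivation.leibniz, smul_eq_mul, vertical_h]
    simp only [𝔽.horizontal_apply (𝔽.Y _ _), 𝔽.vertical_apply (𝔽.δ _ _)]
    simp only [δ_apply, map_sub, map_add, Derivation.leibniz, smul_eq_mul, 𝔽.X_comm_Y, 𝔽.Y_comm 1 0, Fin.sum_univ_two]
    ring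
  obtain ⟨W, hW⟩ := key
  have hE := hW 𝔽.E
  rw [horizontal_E, vertical_E, spray_E, map_zero, map_zero] at hE
  obtain ⟨a, ha⟩ := 𝔽.frame_proportional W (by linear_combination -hE)
  refine ⟨a, fun f => ?_⟩
  rw [hW, ha, ha, vertical_apply]
  ring

theorem berwaldRelations :
    BerwaldRelations 𝔽.spray 𝔽.horizontal 𝔽.vertical 𝔽.ricci 𝔽.mainScalar where
  spray_vertical := 𝔽.spray_vertical_comm
  spray_horizontal := 𝔽.spray_horizontal_comm
  horizontal_vertical := 𝔽.horizontal_vertical_comm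
  independent a b h := by
    have n := 𝔽.h_normalized
    simp only [Fin.sum_univ_two] at n
    -- By normalization 2E lies in the ideal generated by the components of h. Testing on the
    -- coordinates x^j then gives a = 0, and testing on y^j gives b = 0.
    have zero_of : ∀ a : A, a * 𝔽.h 0 = 0 → a * 𝔽.h 1 = 0 → a = 0 := fun a h0 h1 => by
      apply 𝔽.E_cancel
      apply two_mul_cancel
      linear_combination -a * n + (𝔽.Y 0 (𝔽.Y 0 𝔽.E) * 𝔽.h 0 + 𝔽.Y 0 (𝔽.Y 1 𝔽.E) * 𝔽.h 1
        + 𝔽.Y 1 (𝔽.Y 0 𝔽.E) * 𝔽.h 1) * h0 + 𝔽.Y 1 (𝔽.Y 1 𝔽.E) * 𝔽.h 1 * h1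
    have ha : a = 0 := by
      refine zero_of a ?_ ?_
      · simpa [vertical_apply, horizontal_apply, δ_apply, 𝔽.X_x, 𝔽.Y_x] using h (𝔽.x 0)
      · simpa [vertical_apply, horizontal_apply, δ_apply, 𝔽.X_x, 𝔽.Y_x] using h (𝔽.x 1)
    refine ⟨ha, zero_of b ?_ ?_⟩
    · simpa [ha, vertical_apply, 𝔽.Y_y] using h (𝔽.y 0)
    · simpa [ha, vertical_apply, 𝔽.Y_y] using h (𝔽.y 1)

/-! ### From the main scalar to the Cartan tensor. -/

/-- A Finsler function with vanishing main scalar has vanishing Cartan tensor. -/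
theorem cartan_eq_zero (h : 𝔽.mainScalar = 0) (i j k : Fin 2) :
    𝔽.Y k (𝔽.Y i (𝔽.Y j 𝔽.E)) = 0 := by
  have m := 𝔽.mainScalar_mul
  rw [h, mul_zero] at m
  obtain ⟨T, hT⟩ : ∃ T : Fin 2 → Fin 2 → Fin 2 → A, ∀ i j k,
    𝔽.Y k (𝔽.Y i (𝔽.Y j 𝔽.E)) = T i j k := ⟨_, fun _ _ _ => rfl⟩
  have s1 : ∀ i j k, T i j k = T j i k := fun i j k => by
    rw [← hT, ← hT, 𝔽.Y_comm i j]
  have s2 : ∀ i j k, T i j k = T k j i := fun i j k => by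
    rw [← hT, ← hT, 𝔽.Y_comm]
  have hy : ∀ j k, 𝔽.y 0 * T 0 j k + 𝔽.y 1 * T 1 j k = 0 := fun j k => by
    have := congrArg (𝔽.Y k) (𝔽.y_metric j)
    simp only [map_add, Derivation.leibniz, smul_eq_mul, hT, 𝔽.Y_y] at this
    fin_cases k <;> simp at this ⊢
    · linear_combination this
    · linear_combination this
  have e1 : T 1 0 0 = T 0 0 1 := s2 _ _ _
  have e2 : T 0 1 0 = T 0 0 1 := (s1 _ _ _).trans e1
  have e3 : T 1 0 1 = T 0 1 1 := s1 _ _ _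
  have e4 : T 1 1 0 = T 0 1 1 := s2 _ _ _
  simp only [hT] at m ⊢
  -- A covector vanishing on y and h vanishes. The symmetric tensor T is zero as soon as one
  -- argument is y, so T(h,h,h) = 0 kills it after three contractions.
  have contract : ∀ W : Fin 2 → A, 𝔽.y 0 * W 0 + 𝔽.y 1 * W 1 = 0 →
      𝔽.h 0 * W 0 + 𝔽.h 1 * W 1 = 0 → ∀ i, W i = 0 := by
    intro W h0 h1 i
    have f0 := 𝔽.frame_identity 0 i
    have f1 := 𝔽.frame_identity 1 i
    apply 𝔽.E_cancel
    apply two_mul_cancel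
    have : (if 0 = i then 2 * 𝔽.E else 0) * W 0 + (if 1 = i then 2 * 𝔽.E else 0) * W 1
        = 2 * (𝔽.E * W i) := by
      fin_cases i <;> simp <;> ring
    rw [← this, ← f0, ← f1]
    linear_combination 𝔽.Y i 𝔽.E * h0
      + (𝔽.h 0 * 𝔽.Y 0 (𝔽.Y i 𝔽.E) + 𝔽.h 1 * 𝔽.Y 1 (𝔽.Y i 𝔽.E)) * h1
  have c1 : ∀ k, 𝔽.h 0 * (𝔽.h 0 * T 0 0 k + 𝔽.h 1 * T 0 1 k)
      + 𝔽.h 1 * (𝔽.h 0 * T 1 0 k + 𝔽.h 1 * T 1 1 k) = 0 := by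
    refine contract (fun k => 𝔽.h 0 * (𝔽.h 0 * T 0 0 k + 𝔽.h 1 * T 0 1 k)
      + 𝔽.h 1 * (𝔽.h 0 * T 1 0 k + 𝔽.h 1 * T 1 1 k)) ?_ ?_
    · have hy00 := hy 0 0
      have hy01 := hy 0 1
      have hy11 := hy 1 1
      simp only [e1, e2, e3, e4] at hy00 hy01 hy11 ⊢
      linear_combination 𝔽.h 0 ^ 2 * hy00 + 2 * 𝔽.h 0 * 𝔽.h 1 * hy01 + 𝔽.h 1 ^ 2 * hy11
    · simp only [Fin.sum_univ_two] at m
      linear_combination -m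
  have c2 : ∀ j k, 𝔽.h 0 * T 0 j k + 𝔽.h 1 * T 1 j k = 0 := by
    intro j k
    refine contract (fun j => 𝔽.h 0 * T 0 j k + 𝔽.h 1 * T 1 j k) ?_ ?_ j
    · rw [s1 1 0 k]
      have h0 := hy 0 k
      rw [s1 1 0 k] at h0
      linear_combination 𝔽.h 0 * h0 + 𝔽.h 1 * hy 1 k
    · linear_combination c1 k
  exact contract (fun i => T i j k) (hy j k) (c2 j k) i

/-- If `V(ρ) = -𝓘 ρ`, `S(ρ) = 0` and `ρ` is not a zero divisor, then the Cartan tensor vanishes. -/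
theorem cartan_eq_zero_of_ricci (hρ : ∀ a : A, a * 𝔽.ricci ^ 2 = 0 → a = 0)
    (hS : 𝔽.spray 𝔽.ricci = 0) (hV : 𝔽.vertical 𝔽.ricci = -𝔽.mainScalar * 𝔽.ricci)
    (i j k : Fin 2) : 𝔽.Y k (𝔽.Y i (𝔽.Y j 𝔽.E)) = 0 :=
  𝔽.cartan_eq_zero (hρ _ (𝔽.berwaldRelations.mul_sq_eq_zero hS hV)) i j k

end FinslerAlgebra

/-! ### Smooth functions on an open set and their directional derivations. -/

noncomputable section

section SmoothFunctions

variable {W : Type*} [NormedAddCommGroup W] [NormedSpace ℝ W]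

/-- The algebra of restrictions to `U` of functions which are smooth on `U`. -/
def smoothFunctions (U : Set W) : Subalgebra ℝ (U → ℝ) where
  carrier := {f | ∃ g : W → ℝ, ContDiffOn ℝ ∞ g U ∧ f = fun p : U => g p}
  mul_mem' := by
    rintro _ _ ⟨f, hf, rfl⟩ ⟨g, hg, rfl⟩
    exact ⟨_, hf.mul hg, rfl⟩
  add_mem' := by
    rintro _ _ ⟨f, hf, rfl⟩ ⟨g, hg, rfl⟩
    exact ⟨_, hf.add hg, rfl⟩
  algebraMap_mem' r := ⟨_, contDiffOn_const, rfl⟩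

namespace smoothFunctions

variable {U : Set W}

def ofContDiffOn (g : W → ℝ) (hg : ContDiffOn ℝ ∞ g U) : smoothFunctions U :=
  ⟨fun p => g p, by exact ⟨g, hg, rfl⟩⟩

theorem exists_rep (f : smoothFunctions U) :
    ∃ g : W → ℝ, ContDiffOn ℝ ∞ g U ∧ f.1 = fun p : U => g p := f.2

/-- The values of the chosen extension outside U are arbitrary; for open U they do not affect
derivatives at points of U. -/
def rep (f : smoothFunctions U) : W → ℝ := (exists_rep f).choose

theorem contDiffOn_rep (f : smoothFunctions U) : ContDiffOn ℝ ∞ (rep f) U :=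
  (exists_rep f).choose_spec.1

theorem rep_apply (f : smoothFunctions U) {p : W} (hp : p ∈ U) : rep f p = f.1 ⟨p, hp⟩ :=
  (congrFun (exists_rep f).choose_spec.2 ⟨p, hp⟩).symm

theorem ofContDiffOn_rep (f : smoothFunctions U) : ofContDiffOn (rep f) (contDiffOn_rep f) = f :=
  Subtype.ext (exists_rep f).choose_spec.2.symm

theorem ext_on {f g : smoothFunctions U} (h : ∀ p (hp : p ∈ U), f.1 ⟨p, hp⟩ = g.1 ⟨p, hp⟩) :
    f = g :=
  Subtype.ext (funext fun p => h p.1 p.2)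

theorem ofContDiffOn_congr {f g : W → ℝ} {hf : ContDiffOn ℝ ∞ f U} {hg : ContDiffOn ℝ ∞ g U}
    (h : ∀ p ∈ U, f p = g p) : ofContDiffOn f hf = ofContDiffOn g hg :=
  ext_on h

theorem _root_.ContDiffOn.fderiv_apply_const (hU : IsOpen U) {g : W → ℝ}
    (hg : ContDiffOn ℝ ∞ g U) (v : W) : ContDiffOn ℝ ∞ (fun p => fderiv ℝ g p v) U :=
  (hg.fderiv_of_isOpen hU (by simp)).clm_apply contDiffOn_const

theorem _root_.ContDiffOn.differentiableAt_of_isOpen (hU : IsOpen U) {g : W → ℝ}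
    (hg : ContDiffOn ℝ ∞ g U) {p : W} (hp : p ∈ U) : DifferentiableAt ℝ g p :=
  (hg.contDiffAt (hU.mem_nhds hp)).differentiableAt (by simp)

theorem _root_.fderiv_eq_of_eqOn (hU : IsOpen U) {f g : W → ℝ} (h : ∀ p ∈ U, f p = g p) {p : W}
    (hp : p ∈ U) : fderiv ℝ f p = fderiv ℝ g p :=
  Filter.EventuallyEq.fderiv_eq (Filter.eventuallyEq_of_mem (hU.mem_nhds hp) h)

/-- The derivative in the constant direction `v` as a derivation of the smooth functions. -/
def directional (hU : IsOpen U) (v : W) :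
    Derivation ℝ (smoothFunctions U) (smoothFunctions U) :=
  Derivation.mk'
    { toFun := fun f => ofContDiffOn (fun p => fderiv ℝ (rep f) p v) ((contDiffOn_rep f).fderiv_apply_const hU v)
      map_add' := fun f g => ext_on fun p hp => by
        have : ∀ q ∈ U, rep (f + g) q = ((rep f) + (rep g)) q := fun q hq => by
          simp [rep_apply _ hq]
        change fderiv ℝ (rep (f + g)) p v = fderiv ℝ (rep f) p v + fderiv ℝ (rep g) p v
        rw [fderiv_eq_of_eqOn hU this hp,
          fderiv_add ((contDiffOn_rep f).differentiableAt_of_isOpen hU hp)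
          ((contDiffOn_rep g).differentiableAt_of_isOpen hU hp)]
        rfl
      map_smul' := fun r f => ext_on fun p hp => by
        have : ∀ q ∈ U, rep (r • f) q = (r • (rep f)) q := fun q hq => by
          simp [rep_apply _ hq]
        change fderiv ℝ (rep (r • f)) p v = r * fderiv ℝ (rep f) p v
        rw [fderiv_eq_of_eqOn hU this hp,
          fderiv_const_smul ((contDiffOn_rep f).differentiableAt_of_isOpen hU hp)]
        rfl }
    fun f g => ext_on fun p hp => by
      have : ∀ q ∈ U, rep (f * g) q = ((rep f) * (rep g)) q := fun q hq => by
        simp [rep_apply _ hq]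
      change fderiv ℝ (rep (f * g)) p v =
        f.1 ⟨p, hp⟩ * fderiv ℝ (rep g) p v + g.1 ⟨p, hp⟩ * fderiv ℝ (rep f) p v
      rw [fderiv_eq_of_eqOn hU this hp,
        fderiv_mul ((contDiffOn_rep f).differentiableAt_of_isOpen hU hp)
        ((contDiffOn_rep g).differentiableAt_of_isOpen hU hp)]
      simp [rep_apply _ hp]

theorem directional_apply (hU : IsOpen U) (v : W) (f : smoothFunctions U) {p : W} (hp : p ∈ U) :
    (directional hU v f).1 ⟨p, hp⟩ = fderiv ℝ (rep f) p v := rfl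

theorem directional_ofContDiffOn (hU : IsOpen U) (v : W) (g : W → ℝ) (hg : ContDiffOn ℝ ∞ g U) :
    directional hU v (ofContDiffOn g hg) = ofContDiffOn (fun p => fderiv ℝ g p v) (hg.fderiv_apply_const hU v) := by
  refine ext_on fun p hp => ?_
  rw [directional_apply, fderiv_eq_of_eqOn hU (fun q hq => rep_apply (ofContDiffOn g hg) hq) hp]
  rfl

theorem directional_comm (hU : IsOpen U) (v w : W) (f : smoothFunctions U) :
    directional hU v (directional hU w f) = directional hU w (directional hU v f) := by
  rw [← ofContDiffOn_rep f]
  simp only [directional_ofContDiffOn]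
  refine ofContDiffOn_congr fun p hp => ?_
  have hs := (contDiffOn_rep f).contDiffAt (hU.mem_nhds hp)
  have hd : DifferentiableAt ℝ (fderiv ℝ (rep f)) p :=
    (hs.fderiv_right (m := 1) (by norm_cast)).differentiableAt (by simp)
  rw [fderiv_clm_apply hd (differentiableAt_const w), fderiv_clm_apply hd (differentiableAt_const v)]
  simpa using hs.isSymmSndFDerivAt
    (by rw [minSmoothness_of_isRCLikeNormedField]; exact ENat.LEInfty.out) v w

end smoothFunctions

end SmoothFunctions

end

/-! ### A Finsler function in coordinates as an instance of the algebra. -/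

noncomputable section

/-- The normalization of the vector field `F D^{-1/2} (-∂F/∂y², ∂F/∂y¹)`, where `D` is the
determinant of the metric tensor of the Finsler function `F`. -/
theorem FinslerAlgebra.normalized_orthogonal {A : Type*} [CommRing A] [Algebra ℝ A]
    (Y : Fin 2 → Derivation ℝ A A) (hY : ∀ i j f, Y i (Y j f) = Y j (Y i f)) (y : Fin 2 → A)
    (Y_y : ∀ i j, Y i (y j) = if i = j then 1 else 0) (F Finv s : A) (hF : F * Finv = 1)
    (euler : y 0 * Y 0 F + y 1 * Y 1 F = F)
    (hs : s * s * (Y 0 (Y 0 (F * F)) * Y 1 (Y 1 (F * F)) - Y 0 (Y 1 (F * F)) * Y 1 (Y 0 (F * F)))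
      = 4) (h : Fin 2 → A) (h0 : h 0 = -(F * s * Y 1 F)) (h1 : h 1 = F * s * Y 0 F) :
    ∑ i, ∑ j, Y i (Y j (F * F)) * h i * h j = 2 * (F * F) := by
  have e0 := congrArg (Y 0) euler
  have e1 := congrArg (Y 1) euler
  simp only [map_add, Derivation.leibniz, smul_eq_mul, Y_y, hY 1 0, Fin.sum_univ_two, h0, h1]
    at e0 e1 hs ⊢
  simp at e0 e1
  -- By homogeneity y lies in the kernel of the Hessian of F, so its determinant vanishes; the
  -- factor F = y^i ∂F/∂y^i is introduced and then cancelled.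
  have hz : Y 0 (Y 0 F) * Y 1 (Y 1 F) - Y 0 (Y 1 F) * Y 0 (Y 1 F) = 0 := by
    have : F * (Y 0 (Y 0 F) * Y 1 (Y 1 F) - Y 0 (Y 1 F) * Y 0 (Y 1 F)) = 0 := by
      linear_combination (-(Y 0 (Y 0 F) * Y 1 (Y 1 F)) + Y 0 (Y 1 F) * Y 0 (Y 1 F)) * euler
        + (Y 0 F * Y 1 (Y 1 F) - Y 1 F * Y 0 (Y 1 F)) * e0
        + (Y 1 F * Y 0 (Y 0 F) - Y 0 F * Y 0 (Y 1 F)) * e1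
    linear_combination Finv * this - (Y 0 (Y 0 F) * Y 1 (Y 1 F) - Y 0 (Y 1 F) * Y 0 (Y 1 F)) * hF
  refine FinslerAlgebra.two_mul_cancel ?_
  linear_combination F * F * hs - 4 * F ^ 4 * s * s * hz

namespace Finsler

/-- `L` is the coordinate expression on `U` of a smooth Finsler function with positive definite
metric tensor. -/
structure IsFinslerOn (L : Plane × Plane → ℝ) (U : Set (Plane × Plane)) : Prop where
  isOpen : IsOpen U
  smooth : ContDiffOn ℝ ∞ L U
  pos : ∀ p ∈ U, 0 < L p
  homogeneous : ∀ p ∈ U, ∀ t : ℝ, 0 < t → L (p.1, t • p.2) = t * L p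
  det_pos : ∀ p ∈ U, 0 < (metric L p).det

section Smoothness

open smoothFunctions

variable {L : Plane × Plane → ℝ} {U : Set (Plane × Plane)}

theorem contDiffOn_dx (hU : IsOpen U) {f : Plane × Plane → ℝ} (hf : ContDiffOn ℝ ∞ f U)
    (i : Fin 2) : ContDiffOn ℝ ∞ (dx i f) U :=
  hf.fderiv_apply_const hU _

theorem contDiffOn_dy (hU : IsOpen U) {f : Plane × Plane → ℝ} (hf : ContDiffOn ℝ ∞ f U)
    (i : Fin 2) : ContDiffOn ℝ ∞ (dy i f) U :=
  hf.fderiv_apply_const hU _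

theorem contDiffOn_metric (hU : IsOpen U) (hL : ContDiffOn ℝ ∞ L U) (i j : Fin 2) :
    ContDiffOn ℝ ∞ (fun p => metric L p i j) U :=
  contDiffOn_const.mul (contDiffOn_dy hU (contDiffOn_dy hU (hL.pow 2) j) i)

theorem contDiffOn_metric_det (hU : IsOpen U) (hL : ContDiffOn ℝ ∞ L U) :
    ContDiffOn ℝ ∞ (fun p => (metric L p).det) U := by
  simp only [Matrix.det_fin_two]
  exact ((contDiffOn_metric hU hL 0 0).mul (contDiffOn_metric hU hL 1 1)).sub
    ((contDiffOn_metric hU hL 0 1).mul (contDiffOn_metric hU hL 1 0))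

theorem contDiff_base_coord (i : Fin 2) : ContDiff ℝ ∞ fun p : Plane × Plane => p.1 i :=
  ((EuclideanSpace.proj (𝕜 := ℝ) i).comp (ContinuousLinearMap.fst ℝ Plane Plane)).contDiff

theorem contDiff_fibre_coord (i : Fin 2) : ContDiff ℝ ∞ fun p : Plane × Plane => p.2 i :=
  ((EuclideanSpace.proj (𝕜 := ℝ) i).comp (ContinuousLinearMap.snd ℝ Plane Plane)).contDiff

theorem fderiv_base_coord (i : Fin 2) (p u : Plane × Plane) :
    fderiv ℝ (fun p : Plane × Plane => p.1 i) p u = u.1 i := by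
  change fderiv ℝ ((EuclideanSpace.proj (𝕜 := ℝ) i).comp (ContinuousLinearMap.fst ℝ Plane Plane)) p u
    = _
  rw [ContinuousLinearMap.fderiv]
  rfl

theorem fderiv_fibre_coord (i : Fin 2) (p u : Plane × Plane) :
    fderiv ℝ (fun p : Plane × Plane => p.2 i) p u = u.2 i := by
  change fderiv ℝ ((EuclideanSpace.proj (𝕜 := ℝ) i).comp (ContinuousLinearMap.snd ℝ Plane Plane)) p u
    = _
  rw [ContinuousLinearMap.fderiv]
  rfl

theorem fderiv_eq_sum (f : Plane × Plane → ℝ) (p u : Plane × Plane) :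
    fderiv ℝ f p u = ∑ i, u.1 i * dx i f p + ∑ i, u.2 i * dy i f p := by
  have hv : ∀ v : Plane, v = ∑ i, v i • EuclideanSpace.single i (1 : ℝ) := fun v => by
    ext j; fin_cases j <;> simp [Fin.sum_univ_two]
  have hu : u = ∑ i, u.1 i • ((EuclideanSpace.single i 1, 0) : Plane × Plane)
      + ∑ i, u.2 i • ((0, EuclideanSpace.single i 1) : Plane × Plane) := by
    ext1
    · simpa [Fin.sum_univ_two] using hv u.1
    · simpa [Fin.sum_univ_two] using hv u.2
  conv_lhs => rw [hu]
  simp only [map_add, map_sum, map_smul, smul_eq_mul, dx, dy]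

theorem metric_eq (L : Plane × Plane → ℝ) (p : Plane × Plane) (i j : Fin 2) :
    dy i (dy j (fun q => L q ^ 2)) p = 2 * metric L p i j := by
  simp [metric]

theorem directional_dy (hU : IsOpen U) (i : Fin 2) (f : Plane × Plane → ℝ)
    (hf : ContDiffOn ℝ ∞ f U) :
    directional hU (0, EuclideanSpace.single i 1) (ofContDiffOn f hf) =
      ofContDiffOn (dy i f) (contDiffOn_dy hU hf i) :=
  directional_ofContDiffOn hU _ f hf

theorem directional_dx (hU : IsOpen U) (i : Fin 2) (f : Plane × Plane → ℝ)
    (hf : ContDiffOn ℝ ∞ f U) :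
    directional hU (EuclideanSpace.single i 1, 0) (ofContDiffOn f hf) =
      ofContDiffOn (dx i f) (contDiffOn_dx hU hf i) :=
  directional_ofContDiffOn hU _ f hf

/-- The components of the vertical vector field of the Berwald frame. -/
def frame (L : Plane × Plane → ℝ) (i : Fin 2) (p : Plane × Plane) : ℝ :=
  ![-(L p * (√(metric L p).det)⁻¹ * dy 1 L p), L p * (√(metric L p).det)⁻¹ * dy 0 L p] i

end Smoothness

namespace IsFinslerOn

open smoothFunctions

variable {L : Plane × Plane → ℝ} {U : Set (Plane × Plane)} (D : IsFinslerOn L U)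
include D

theorem contDiffOn_metric_inv (i j : Fin 2) :
    ContDiffOn ℝ ∞ (fun p => (metric L p)⁻¹ i j) U := by
  have hm := contDiffOn_metric D.isOpen D.smooth
  have hd := (contDiffOn_metric_det D.isOpen D.smooth).inv fun p hp => (D.det_pos p hp).ne'
  simp only [Matrix.inv_def, Ring.inverse_eq_inv', Matrix.smul_apply, smul_eq_mul,
    Matrix.adjugate_fin_two]
  refine hd.mul ?_
  fin_cases i <;> fin_cases j
  · exact hm 1 1
  · exact (hm 0 1).neg
  · exact (hm 1 0).neg
  · exact hm 0 0

theorem contDiffOn_sprayCoeff (i : Fin 2) : ContDiffOn ℝ ∞ (sprayCoeff L i) U := by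
  refine contDiffOn_const.mul (ContDiffOn.sum fun l _ => (D.contDiffOn_metric_inv i l).mul
    (ContDiffOn.sub (ContDiffOn.sum fun k _ => (contDiff_fibre_coord k).contDiffOn.mul ?_) ?_))
  · exact contDiffOn_dx D.isOpen (contDiffOn_dy D.isOpen (D.smooth.pow 2) l) k
  · exact contDiffOn_dx D.isOpen (D.smooth.pow 2) l

theorem contDiffOn_connCoeff (i j : Fin 2) : ContDiffOn ℝ ∞ (connCoeff L i j) U :=
  contDiffOn_dy D.isOpen (D.contDiffOn_sprayCoeff i) j

theorem contDiffOn_spray_apply {f : Plane × Plane → ℝ} (hf : ContDiffOn ℝ ∞ f U) :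
    ContDiffOn ℝ ∞ (fun p => fderiv ℝ f p (spray L p)) U := by
  simp only [fderiv_eq_sum]
  refine ContDiffOn.add (ContDiffOn.sum fun i _ => ?_) (ContDiffOn.sum fun i _ => ?_)
  · exact (contDiff_fibre_coord i).contDiffOn.mul (contDiffOn_dx D.isOpen hf i)
  · exact (contDiffOn_const.mul (D.contDiffOn_sprayCoeff i)).mul (contDiffOn_dy D.isOpen hf i)

theorem contDiffOn_ricciScalar : ContDiffOn ℝ ∞ (ricciScalar L) U := by
  have : ricciScalar L = fun p => ∑ i, jacobiEndo L p i i := rfl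
  rw [this]
  refine ContDiffOn.sum fun i _ => ?_
  refine ContDiffOn.sub (ContDiffOn.sub ?_ ?_) (ContDiffOn.sum fun k _ => ?_)
  · exact contDiffOn_const.mul (contDiffOn_dx D.isOpen (D.contDiffOn_sprayCoeff i) i)
  · exact D.contDiffOn_spray_apply (D.contDiffOn_connCoeff i i)
  · exact (D.contDiffOn_connCoeff i k).mul (D.contDiffOn_connCoeff k i)

theorem euler (p : Plane × Plane) (hp : p ∈ U) : ∑ i, p.2 i * dy i L p = L p := by
  have h1 : HasDerivAt (fun t : ℝ => L (p.1, t • p.2)) (L p) 1 := by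
    have : HasDerivAt (fun t : ℝ => t * L p) (1 * L p) 1 := (hasDerivAt_id _).mul_const _
    rw [one_mul] at this
    refine this.congr_of_eventuallyEq ?_
    filter_upwards [lt_mem_nhds (zero_lt_one (α := ℝ))] with t ht
    exact D.homogeneous p hp t ht
  have h2 : HasDerivAt (fun t : ℝ => L (p.1, t • p.2)) (fderiv ℝ L p (0, p.2)) 1 := by
    have hL := (D.smooth.differentiableAt_of_isOpen D.isOpen hp).hasFDerivAt
    have hc : HasDerivAt (fun t : ℝ => ((p.1, t • p.2) : Plane × Plane)) (0, p.2) 1 := by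
      refine (hasDerivAt_const _ _).prodMk ?_
      simpa using (hasDerivAt_id (1 : ℝ)).smul_const p.2
    have hL' : HasFDerivAt L (fderiv ℝ L p) ((p.1, (1 : ℝ) • p.2) : Plane × Plane) := by
      simpa using hL
    exact hL'.comp_hasDerivAt 1 hc
  have h3 := h1.unique h2
  rw [fderiv_eq_sum] at h3
  simpa using h3.symm

theorem metric_symm (p : Plane × Plane) (hp : p ∈ U) (i j : Fin 2) :
    metric L p i j = metric L p j i := by
  have h := directional_comm D.isOpen (0, EuclideanSpace.single i 1) (0, EuclideanSpace.single j 1)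
    (ofContDiffOn (fun q => L q ^ 2) (D.smooth.pow 2))
  simp only [directional_dy] at h
  exact congrArg (fun t => 1 / 2 * t) (congrFun (congrArg Subtype.val h) ⟨p, hp⟩)

theorem contDiffOn_inv_sqrt_det : ContDiffOn ℝ ∞ (fun p => (√(metric L p).det)⁻¹) U :=
  ((contDiffOn_metric_det D.isOpen D.smooth).sqrt fun p hp => (D.det_pos p hp).ne').inv
    fun p hp => (Real.sqrt_pos.2 (D.det_pos p hp)).ne'

theorem contDiffOn_frame (i : Fin 2) : ContDiffOn ℝ ∞ (frame L i) U := by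
  have h := D.smooth.mul D.contDiffOn_inv_sqrt_det
  fin_cases i
  · exact (h.mul (contDiffOn_dy D.isOpen D.smooth 1)).neg
  · exact h.mul (contDiffOn_dy D.isOpen D.smooth 0)

theorem ofContDiffOn_sq : ofContDiffOn (fun q => L q ^ 2) (D.smooth.pow 2) =
    ofContDiffOn L D.smooth * ofContDiffOn L D.smooth :=
  ext_on fun p _ => sq (L p)

theorem euler_ofContDiffOn :
    ofContDiffOn _ (contDiff_fibre_coord 0).contDiffOn *
        directional D.isOpen (0, EuclideanSpace.single 0 1) (ofContDiffOn L D.smooth) +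
      ofContDiffOn _ (contDiff_fibre_coord 1).contDiffOn *
        directional D.isOpen (0, EuclideanSpace.single 1 1) (ofContDiffOn L D.smooth) =
      ofContDiffOn L D.smooth := by
  simp only [directional_dy]
  refine ext_on fun p hp => ?_
  have h := D.euler p hp
  rw [Fin.sum_univ_two] at h
  exact h

theorem ofContDiffOn_frame_zero : ofContDiffOn _ (D.contDiffOn_frame 0) =
    -(ofContDiffOn L D.smooth * ofContDiffOn _ D.contDiffOn_inv_sqrt_det *
      directional D.isOpen (0, EuclideanSpace.single 1 1) (ofContDiffOn L D.smooth)) := by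
  rw [directional_dy]
  rfl

theorem ofContDiffOn_frame_one : ofContDiffOn _ (D.contDiffOn_frame 1) =
    ofContDiffOn L D.smooth * ofContDiffOn _ D.contDiffOn_inv_sqrt_det *
      directional D.isOpen (0, EuclideanSpace.single 0 1) (ofContDiffOn L D.smooth) := by
  rw [directional_dy]
  rfl

theorem directional_fibre_coord (i j : Fin 2) :
    directional D.isOpen (0, EuclideanSpace.single i 1)
      (ofContDiffOn _ (contDiff_fibre_coord j).contDiffOn) = if i = j then 1 else 0 := by
  rw [directional_ofContDiffOn]
  refine ext_on fun p hp => ?_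
  change fderiv ℝ _ p _ = _
  rw [fderiv_fibre_coord]
  split_ifs with h
  · simp [h]
  · simp [Ne.symm h]

theorem sprayCoeff_metric (p : Plane × Plane) (hp : p ∈ U) (l : Fin 2) :
    (∑ k, p.2 k * dx k (dy l (fun q => L q ^ 2)) p) - dx l (fun q => L q ^ 2) p =
      4 * ∑ k, sprayCoeff L k p * metric L p k l := by
  have hinv : (metric L p) * (metric L p)⁻¹ = 1 :=
    Matrix.mul_nonsing_inv _ (isUnit_iff_ne_zero.2 (D.det_pos p hp).ne')
  set R : Fin 2 → ℝ := fun l =>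
    (∑ k, p.2 k * dx k (dy l (fun q => L q ^ 2)) p) - dx l (fun q => L q ^ 2) p with hR
  have hG : ∀ k, sprayCoeff L k p = 1 / 4 * ((metric L p)⁻¹.mulVec R) k := fun k => rfl
  have h : (metric L p).mulVec ((metric L p)⁻¹.mulVec R) = R := by
    rw [Matrix.mulVec_mulVec, hinv, Matrix.one_mulVec]
  have hl := congrFun h l
  change R l = _
  rw [← hl]
  simp only [hG, Matrix.mulVec, dotProduct, Finset.mul_sum]
  refine Finset.sum_congr rfl fun k _ => ?_
  rw [D.metric_symm p hp l k]
  simp only [Fin.sum_univ_two]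
  ring

/-- The differential algebra of a Finsler function. -/
def algebra : FinslerAlgebra (smoothFunctions U) where
  X i := directional D.isOpen (EuclideanSpace.single i 1, 0)
  Y i := directional D.isOpen (0, EuclideanSpace.single i 1)
  x i := ofContDiffOn _ (contDiff_base_coord i).contDiffOn
  y i := ofContDiffOn _ (contDiff_fibre_coord i).contDiffOn
  X_comm_Y i j f := directional_comm _ _ _ _
  X_comm i j f := directional_comm _ _ _ _
  Y_comm i j f := directional_comm _ _ _ _
  X_x i j := by
    rw [directional_ofContDiffOn]
    refine ext_on fun p hp => ?_
    change fderiv ℝ _ p _ = _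
    rw [fderiv_base_coord]
    split_ifs with h
    · simp [h]
    · simp [Ne.symm h]
  Y_x i j := by
    rw [directional_ofContDiffOn]
    refine ext_on fun p hp => ?_
    change fderiv ℝ _ p _ = _
    rw [fderiv_base_coord]
    rfl
  X_y i j := by
    rw [directional_ofContDiffOn]
    refine ext_on fun p hp => ?_
    change fderiv ℝ _ p _ = _
    rw [fderiv_fibre_coord]
    rfl
  Y_y := D.directional_fibre_coord
  E := ofContDiffOn (fun q => L q ^ 2) (D.smooth.pow 2)
  Einv := ofContDiffOn (fun q => (L q ^ 2)⁻¹) ((D.smooth.pow 2).inv fun p hp => (pow_pos (D.pos p hp) 2).ne')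
  E_inv := ext_on fun p hp => mul_inv_cancel₀ (pow_pos (D.pos p hp) 2).ne'
  euler := by
    rw [D.ofContDiffOn_sq, Fin.sum_univ_two, Derivation.leibniz, Derivation.leibniz, smul_eq_mul,
      smul_eq_mul]
    linear_combination 2 * ofContDiffOn L D.smooth * D.euler_ofContDiffOn
  G i := ofContDiffOn _ (D.contDiffOn_sprayCoeff i)
  geodesic l := by
    simp only [directional_dy, directional_dx, Fin.sum_univ_two, two_mul]
    refine ext_on fun p hp => ?_
    have h := D.sprayCoeff_metric p hp l
    simp only [Fin.sum_univ_two] at h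
    refine h.trans ?_
    change _ = sprayCoeff L 0 p * dy 0 (dy l (fun q => L q ^ 2)) p
      + sprayCoeff L 1 p * dy 1 (dy l (fun q => L q ^ 2)) p
      + (sprayCoeff L 0 p * dy 0 (dy l (fun q => L q ^ 2)) p
      + sprayCoeff L 1 p * dy 1 (dy l (fun q => L q ^ 2)) p)
    simp only [metric_eq]
    ring
  h i := ofContDiffOn _ (D.contDiffOn_frame i)
  h_orthogonal := by
    rw [D.ofContDiffOn_sq, Fin.sum_univ_two, Derivation.leibniz, Derivation.leibniz, smul_eq_mul,
      smul_eq_mul, D.ofContDiffOn_frame_zero, D.ofContDiffOn_frame_one]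
    ring
  h_normalized := by
    rw [D.ofContDiffOn_sq]
    refine FinslerAlgebra.normalized_orthogonal
      (fun i => directional D.isOpen (0, EuclideanSpace.single i 1))
      (fun i j f => directional_comm _ _ _ _) _ D.directional_fibre_coord _
      (ofContDiffOn (fun p => (L p)⁻¹) (D.smooth.inv fun p hp => (D.pos p hp).ne'))
      (ofContDiffOn _ D.contDiffOn_inv_sqrt_det)
      (ext_on fun p hp => mul_inv_cancel₀ (D.pos p hp).ne')
      D.euler_ofContDiffOn ?_ _ D.ofContDiffOn_frame_zero D.ofContDiffOn_frame_one
    rw [← D.ofContDiffOn_sq]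
    simp only [directional_dy]
    refine ext_on fun p hp => ?_
    change (√(metric L p).det)⁻¹ * (√(metric L p).det)⁻¹ *
      (dy 0 (dy 0 (fun q => L q ^ 2)) p * dy 1 (dy 1 (fun q => L q ^ 2)) p
      - dy 0 (dy 1 (fun q => L q ^ 2)) p * dy 1 (dy 0 (fun q => L q ^ 2)) p) = (4 : ℝ)
    have hd := D.det_pos p hp
    simp only [metric_eq]
    rw [← mul_inv, Real.mul_self_sqrt hd.le, inv_mul_eq_div, div_eq_iff hd.ne', Matrix.det_fin_two]
    ring

end IsFinslerOn

end Finsler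

end

/-! ### Pointwise form of the algebraic identities. -/

noncomputable section

namespace Finsler

/-- The value at `p` of a horizontal vector field of a Berwald frame. -/
def berwaldVector (L : Plane × Plane → ℝ) (p : Plane × Plane) : Plane × Plane :=
  (WithLp.toLp 2 fun i => frame L i p,
    WithLp.toLp 2 fun i => -∑ j, connCoeff L i j p * frame L j p)

namespace IsFinslerOn

open smoothFunctions

variable {L : Plane × Plane → ℝ} {U : Set (Plane × Plane)} (D : IsFinslerOn L U)
include D

theorem algebra_spray_apply {f : Plane × Plane → ℝ} (hf : ContDiffOn ℝ ∞ f U) :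
    D.algebra.spray (ofContDiffOn f hf) =
      ofContDiffOn (fun p => fderiv ℝ f p (spray L p)) (D.contDiffOn_spray_apply hf) := by
  refine ext_on fun p hp => ?_
  rw [FinslerAlgebra.spray_apply]
  simp only [algebra, directional_dy, directional_dx, two_mul]
  change _ = fderiv ℝ f p (spray L p)
  rw [fderiv_eq_sum, Fin.sum_univ_two, Fin.sum_univ_two]
  change p.2 0 * dx 0 f p + p.2 1 * dx 1 f p
    - ((sprayCoeff L 0 p + sprayCoeff L 0 p) * dy 0 f p
      + (sprayCoeff L 1 p + sprayCoeff L 1 p) * dy 1 f p) =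
    p.2 0 * dx 0 f p + p.2 1 * dx 1 f p + (-2 * sprayCoeff L 0 p * dy 0 f p
      + -2 * sprayCoeff L 1 p * dy 1 f p)
  ring

theorem algebra_vertical_apply {f : Plane × Plane → ℝ} (hf : ContDiffOn ℝ ∞ f U)
    {p : Plane × Plane} (hp : p ∈ U) :
    (D.algebra.vertical (ofContDiffOn f hf)).1 ⟨p, hp⟩ =
      fderiv ℝ f p (almostTangent (berwaldVector L p)) := by
  rw [FinslerAlgebra.vertical_apply]
  simp only [algebra, directional_dy]
  rw [fderiv_eq_sum, Fin.sum_univ_two, Fin.sum_univ_two]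
  change frame L 0 p * dy 0 f p + frame L 1 p * dy 1 f p =
    0 * dx 0 f p + 0 * dx 1 f p + (frame L 0 p * dy 0 f p + frame L 1 p * dy 1 f p)
  ring

theorem algebra_ricci :
    D.algebra.ricci = ofContDiffOn (ricciScalar L) D.contDiffOn_ricciScalar := by
  have hY : ∀ i j, D.algebra.Y j (D.algebra.G i) =
      ofContDiffOn (connCoeff L i j) (D.contDiffOn_connCoeff i j) := fun i j =>
    directional_dy D.isOpen j _ (D.contDiffOn_sprayCoeff i)
  have hX : ∀ i j, D.algebra.X j (D.algebra.G i) =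
      ofContDiffOn (dx j (sprayCoeff L i)) (contDiffOn_dx D.isOpen (D.contDiffOn_sprayCoeff i) j) :=
    fun i j => directional_dx D.isOpen j _ (D.contDiffOn_sprayCoeff i)
  simp only [FinslerAlgebra.ricci, FinslerAlgebra.jacobi, hX, hY, D.algebra_spray_apply,
    Fin.sum_univ_two, two_mul]
  refine ext_on fun p hp => ?_
  change _ = ∑ i, (2 * dx i (sprayCoeff L i) p - fderiv ℝ (connCoeff L i i) p (spray L p)
    - ∑ k, connCoeff L i k p * connCoeff L k i p)
  simp only [Fin.sum_univ_two, two_mul]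
  rfl

theorem algebra_E : D.algebra.E = ofContDiffOn (fun q => L q ^ 2) (D.smooth.pow 2) := rfl

theorem fderiv_sq_apply {p : Plane × Plane} (hp : p ∈ U) (u : Plane × Plane) :
    fderiv ℝ (fun q => L q ^ 2) p u = 2 * L p * fderiv ℝ L p u := by
  rw [fderiv_fun_pow 2 (D.smooth.differentiableAt_of_isOpen D.isOpen hp)]
  simp

/-- The Finsler function is constant along the geodesic flow. -/
theorem fderiv_spray {p : Plane × Plane} (hp : p ∈ U) : fderiv ℝ L p (spray L p) = 0 := by
  have h := D.algebra.spray_E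
  rw [algebra_E, D.algebra_spray_apply] at h
  have h2 : fderiv ℝ (fun q => L q ^ 2) p (spray L p) = 0 :=
    congrFun (congrArg Subtype.val h) ⟨p, hp⟩
  rw [D.fderiv_sq_apply hp] at h2
  simpa [(D.pos p hp).ne'] using h2

/-- The explicit frame is an admissible choice, so a condition on all Berwald vectors may be applied
to it. -/
theorem isBerwaldVector {p : Plane × Plane} (hp : p ∈ U) :
    IsBerwaldVector L p (berwaldVector L p) where
  horizontal _ := rfl
  vertical_deriv := by
    have h := congrFun (congrArg Subtype.val D.algebra.vertical_E) ⟨p, hp⟩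
    rw [algebra_E, D.algebra_vertical_apply _ hp, D.fderiv_sq_apply hp] at h
    simpa [(D.pos p hp).ne'] using h
  normalized := by
    have h := D.algebra.h_normalized
    rw [algebra_E] at h
    simp only [algebra, directional_dy, Fin.sum_univ_two, two_mul] at h
    have h2 := congrFun (congrArg Subtype.val h) ⟨p, hp⟩
    change dy 0 (dy 0 (fun q => L q ^ 2)) p * frame L 0 p * frame L 0 p
      + dy 0 (dy 1 (fun q => L q ^ 2)) p * frame L 0 p * frame L 1 p
      + (dy 1 (dy 0 (fun q => L q ^ 2)) p * frame L 1 p * frame L 0 p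
      + dy 1 (dy 1 (fun q => L q ^ 2)) p * frame L 1 p * frame L 1 p) = L p ^ 2 + L p ^ 2 at h2
    simp only [metric_eq] at h2
    simp only [Fin.sum_univ_two, berwaldVector]
    linarith

theorem dy_metric {p : Plane × Plane} (hp : p ∈ U) (i j k : Fin 2) :
    (D.algebra.Y k (D.algebra.Y i (D.algebra.Y j D.algebra.E))).1 ⟨p, hp⟩ =
      2 * dy k (fun q => metric L q i j) p := by
  have h1 : (D.algebra.Y k (D.algebra.Y i (D.algebra.Y j D.algebra.E))).1 ⟨p, hp⟩ =
      dy k (dy i (dy j fun q => L q ^ 2)) p := by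
    rw [algebra_E]
    simp only [algebra, directional_dy]
    rfl
  have h2 : (dy i (dy j fun q => L q ^ 2)) = fun q => 2 * metric L q i j :=
    funext fun q => metric_eq L q i j
  rw [h1, h2, dy, fderiv_const_mul
    ((contDiffOn_metric D.isOpen D.smooth i j).differentiableAt_of_isOpen D.isOpen hp)]
  rfl

theorem algebra_mainScalar {p : Plane × Plane} (hp : p ∈ U) :
    D.algebra.mainScalar.1 ⟨p, hp⟩ = mainScalar L p (berwaldVector L p) := by
  have h := D.algebra.mainScalar_mul
  have h4 : ∀ a : smoothFunctions U, 4 * a = a + a + a + a := fun a => by ring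
  rw [mul_assoc, h4] at h
  have h2 := congrFun (congrArg Subtype.val h) ⟨p, hp⟩
  have h3 : (∑ i, ∑ j, ∑ k, D.algebra.Y k (D.algebra.Y i (D.algebra.Y j D.algebra.E))
      * D.algebra.h i * D.algebra.h j * D.algebra.h k).1 ⟨p, hp⟩
      = 4 * ∑ i, ∑ j, ∑ k, cartan L p i j k * frame L i p * frame L j p * frame L k p := by
    have e : ∀ i j k, (D.algebra.Y k (D.algebra.Y i (D.algebra.Y j D.algebra.E))
      * D.algebra.h i * D.algebra.h j * D.algebra.h k).1 ⟨p, hp⟩ =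
        4 * (cartan L p i j k * frame L i p * frame L j p * frame L k p) := fun i j k => by
      change (D.algebra.Y k (D.algebra.Y i (D.algebra.Y j D.algebra.E))).1 ⟨p, hp⟩
        * frame L i p * frame L j p * frame L k p = _
      rw [D.dy_metric hp, cartan]
      ring
    simp only [Fin.sum_univ_two, Subalgebra.coe_add, Pi.add_apply]
    linear_combination e 0 0 0 + e 0 0 1 + e 0 1 0 + e 0 1 1 + e 1 0 0 + e 1 0 1 + e 1 1 0
      + e 1 1 1
  change L p ^ 2 * D.algebra.mainScalar.1 ⟨p, hp⟩ + L p ^ 2 * D.algebra.mainScalar.1 ⟨p, hp⟩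
    + L p ^ 2 * D.algebra.mainScalar.1 ⟨p, hp⟩ + L p ^ 2 * D.algebra.mainScalar.1 ⟨p, hp⟩ = _ at h2
  rw [h3] at h2
  rw [mainScalar, eq_div_iff (pow_pos (D.pos p hp) 2).ne']
  change _ = ∑ i, ∑ j, ∑ k, cartan L p i j k * frame L i p * frame L j p * frame L k p
  linarith

/-- A nonflat Finsler function with `S(ρ) = 0` and `V(ρ) = -𝓘 ρ` has a metric tensor which does not
depend on the direction. -/
theorem dy_metric_eq_zero (hρ : ∀ p ∈ U, ricciScalar L p ≠ 0)
    (hS : ∀ p ∈ U, fderiv ℝ (ricciScalar L) p (spray L p) = 0)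
    (hV : ∀ p ∈ U, ∀ H, IsBerwaldVector L p H →
      fderiv ℝ (ricciScalar L) p (almostTangent H) = -mainScalar L p H * ricciScalar L p)
    {p : Plane × Plane} (hp : p ∈ U) (i j k : Fin 2) : dy k (fun q => metric L q i j) p = 0 := by
  have h := D.algebra.cartan_eq_zero_of_ricci (fun a ha => ?_) ?_ ?_ i j k
  · have h2 := D.dy_metric hp i j k
    rw [h] at h2
    change (0 : ℝ) = _ at h2
    linarith
  · refine ext_on fun q hq => ?_
    rw [algebra_ricci, sq] at ha
    have h2 : a.1 ⟨q, hq⟩ * (ricciScalar L q * ricciScalar L q) = 0 :=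
      congrFun (congrArg Subtype.val ha) ⟨q, hq⟩
    simpa [hρ q hq] using h2
  · rw [algebra_ricci, D.algebra_spray_apply]
    exact ext_on fun q hq => hS q hq
  · rw [algebra_ricci]
    refine ext_on fun q hq => ?_
    rw [D.algebra_vertical_apply _ hq, hV q hq _ (D.isBerwaldVector hq), ← D.algebra_mainScalar hq]
    rfl

/-- A direction that annihilates L treats L² as a constant; both V and S are such directions. -/
theorem fderiv_flagCurvature {p : Plane × Plane} (hp : p ∈ U) {u : Plane × Plane}
    (hu : fderiv ℝ L p u = 0) :
    fderiv ℝ (flagCurvature L) p u = fderiv ℝ (ricciScalar L) p u / L p ^ 2 := by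
  have hρ := (D.contDiffOn_ricciScalar.differentiableAt_of_isOpen D.isOpen hp).hasFDerivAt
  have hL := ((D.smooth.pow 2).differentiableAt_of_isOpen D.isOpen hp).hasFDerivAt
  have hne := (pow_pos (D.pos p hp) 2).ne'
  have h0 : fderiv ℝ (fun q => L q ^ 2) p u = 0 := by rw [D.fderiv_sq_apply hp, hu, mul_zero]
  have hK : flagCurvature L = ricciScalar L * ((fun t => t⁻¹) ∘ fun q => L q ^ 2) :=
    funext fun q => div_eq_mul_inv _ _
  rw [hK, (hρ.mul ((hasDerivAt_inv hne).comp_hasFDerivAt p hL)).fderiv]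
  simp [h0]
  field_simp

end IsFinslerOn

end Finsler

end

/-! ### Positivity of the metric tensor, and its independence of the direction. -/

noncomputable section

/-- The second-order necessary condition for a local minimum. -/
theorem IsLocalMin.nonneg_of_hasDerivAt {f f' : ℝ → ℝ} {a c : ℝ} (h : IsLocalMin f a)
    (hf : ∀ᶠ t in nhds a, HasDerivAt f (f' t) t) (hf' : HasDerivAt f' c a) : 0 ≤ c := by
  by_contra! hc
  have hd : deriv f =ᶠ[nhds a] f' := hf.mono fun t ht => ht.deriv
  have h2 : deriv (deriv f) a = c := by rw [hd.deriv_eq, hf'.deriv]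
  -- With c < 0 the point would also be a local maximum, so f would be locally constant and c = 0.
  have hmax := isLocalMax_of_deriv_deriv_neg (h2 ▸ hc) h.deriv_eq_zero hf.self_of_nhds.continuousAt
  have hconst : f =ᶠ[nhds a] fun _ => f a := by
    filter_upwards [h, hmax] with t h1 h2 using le_antisymm h2 h1
  have : deriv f =ᶠ[nhds a] fun _ => 0 := by
    filter_upwards [hconst.eventuallyEq_nhds] with t ht
    rw [ht.deriv_eq, deriv_const]
  rw [this.deriv_eq, deriv_const] at h2
  exact hc.ne h2.symm

/-- Used twice: for the constant sign of det g and for the constancy of g along each tangent plane.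
-/
theorem isPreconnected_plane_compl_zero : IsPreconnected ({0}ᶜ : Set Plane) := by
  refine (isConnected_compl_singleton_of_one_lt_rank ?_ 0).isPreconnected
  rw [← Module.finrank_eq_rank]
  simp

/-- A positive function on the slit plane, homogeneous of degree two, attains the minimum of its
quotient by the square of the norm. -/
theorem exists_min_quotient_norm_sq {f : Plane → ℝ} (hc : ContinuousOn f {0}ᶜ)
    (hpos : ∀ y, y ≠ 0 → 0 < f y) (hh : ∀ y, y ≠ 0 → ∀ t : ℝ, 0 < t → f (t • y) = t ^ 2 * f y) :
    ∃ c > 0, (∀ y, y ≠ 0 → c * ‖y‖ ^ 2 ≤ f y) ∧ ∃ y, y ≠ 0 ∧ f y = c * ‖y‖ ^ 2 := by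
  have hne : (Metric.sphere (0 : Plane) 1).Nonempty := NormedSpace.sphere_nonempty.2 zero_le_one
  have hs : ∀ y ∈ Metric.sphere (0 : Plane) 1, y ≠ 0 := fun y hy => by
    rintro rfl
    simp at hy
  obtain ⟨y₀, hy₀, hmin⟩ := (isCompact_sphere (0 : Plane) 1).exists_isMinOn hne
    (hc.mono fun y hy => hs y hy)
  have h1 : ‖y₀‖ = 1 := by simpa using hy₀
  refine ⟨f y₀, hpos _ (hs _ hy₀), fun y hy => ?_, y₀, hs _ hy₀, by simp [h1]⟩
  have hn : 0 < ‖y‖ := norm_pos_iff.2 hy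
  have hy1 : (‖y‖⁻¹ • y) ∈ Metric.sphere (0 : Plane) 1 := by
    simp [norm_smul, hn.ne']
  have h2 : f y₀ ≤ f (‖y‖⁻¹ • y) := hmin hy1
  rw [hh y hy _ (inv_pos.2 hn), inv_pow, inv_mul_eq_div, le_div_iff₀ (by positivity)] at h2
  exact h2

namespace Finsler

variable {L : Plane × Plane → ℝ} {U : Set (Plane × Plane)}

theorem hasDerivAt_line (hU : IsOpen U) {f : Plane × Plane → ℝ} (hf : ContDiffOn ℝ ∞ f U)
    {x y v : Plane} {t : ℝ} (h : (x, y + t • v) ∈ U) :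
    HasDerivAt (fun s : ℝ => f (x, y + s • v)) (∑ i, v i * dy i f (x, y + t • v)) t := by
  have h1 := (hf.differentiableAt_of_isOpen hU h).hasFDerivAt
  have h2 : HasDerivAt (fun s : ℝ => ((x, y + s • v) : Plane × Plane)) (0, v) t := by
    refine (hasDerivAt_const _ _).prodMk ?_
    simpa using ((hasDerivAt_id t).smul_const v).const_add y
  have h3 := h1.comp_hasDerivAt t h2
  refine h3.congr_deriv ?_
  rw [fderiv_eq_sum]
  simp

/-- Along t ↦ y + tv the function L² - c‖·‖² has a local minimum at 0, with second derivative
2(g(v,v) - c‖v‖²). -/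
theorem metric_pos_of_min (hU : IsOpen U) (hL : ContDiffOn ℝ ∞ L U) {x y : Plane} {c : ℝ}
    (hxy : (x, y) ∈ U) (hmin : ∀ y', (x, y') ∈ U → c * ‖y'‖ ^ 2 ≤ L (x, y') ^ 2)
    (hy : L (x, y) ^ 2 = c * ‖y‖ ^ 2) (v : Plane) :
    c * ‖v‖ ^ 2 ≤ ∑ i, ∑ j, metric L (x, y) i j * v i * v j := by
  have hev : ∀ᶠ t : ℝ in nhds 0, (x, y + t • v) ∈ U := by
    have hcont : ContinuousAt (fun t : ℝ => ((x, y + t • v) : Plane × Plane)) 0 := by fun_prop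
    exact hcont.eventually (by simpa using hU.mem_nhds hxy)
  have hnorm : ∀ t : ℝ, c * ‖y + t • v‖ ^ 2 =
      c * ‖y‖ ^ 2 + 2 * c * inner ℝ y v * t + c * ‖v‖ ^ 2 * t ^ 2 := fun t => by
    rw [norm_add_sq_real, inner_smul_right, norm_smul, mul_pow, Real.norm_eq_abs, sq_abs]
    ring
  have hsq := hL.pow 2
  have hn : ∀ t : ℝ, HasDerivAt (fun s : ℝ => c * ‖y + s • v‖ ^ 2)
      (2 * c * inner ℝ y v + 2 * (c * ‖v‖ ^ 2) * t) t := fun t => by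
    simp only [hnorm]
    have := (((hasDerivAt_id t).const_mul (2 * c * inner ℝ y v)).const_add (c * ‖y‖ ^ 2)).add
      (((hasDerivAt_id t).pow 2).const_mul (c * ‖v‖ ^ 2))
    refine this.congr_deriv ?_
    simp
    ring
  have hlm : IsLocalMin (fun t : ℝ => L (x, y + t • v) ^ 2 - c * ‖y + t • v‖ ^ 2) 0 := by
    filter_upwards [hev] with t ht
    have := hmin _ ht
    simp only [zero_smul, add_zero, hy]
    linarith
  have h0 : (x, y + (0 : ℝ) • v) ∈ U := by simpa using hxy
  have hdd : HasDerivAt (fun t : ℝ => (∑ j, v j * dy j (fun q => L q ^ 2) (x, y + t • v))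
      - (2 * c * inner ℝ y v + 2 * (c * ‖v‖ ^ 2) * t))
      ((∑ j, v j * ∑ i, v i * dy i (dy j (fun q => L q ^ 2)) (x, y))
      - 2 * (c * ‖v‖ ^ 2)) 0 := by
    refine HasDerivAt.sub (HasDerivAt.fun_sum fun j _ => HasDerivAt.const_mul _ ?_) ?_
    · simpa using hasDerivAt_line hU (contDiffOn_dy hU hsq j) h0
    · simpa using ((hasDerivAt_id (0 : ℝ)).const_mul (2 * (c * ‖v‖ ^ 2))).const_add
        (2 * c * inner ℝ y v)
  have := hlm.nonneg_of_hasDerivAt (hev.mono fun t ht => (hasDerivAt_line hU hsq ht).sub (hn t)) hdd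
  simp only [metric_eq, Fin.sum_univ_two] at this ⊢
  linarith

/-- Where L²/‖y‖² is minimal on the fibre, g is positive definite. Elsewhere on the connected slit
plane the determinant keeps its sign, since it never vanishes. -/
theorem metric_det_pos {W : Set Plane} (hU : IsOpen {p : Plane × Plane | p.1 ∈ W ∧ p.2 ≠ 0})
    (hL : ContDiffOn ℝ ∞ L {p : Plane × Plane | p.1 ∈ W ∧ p.2 ≠ 0})
    (hpos : ∀ x ∈ W, ∀ y, y ≠ 0 → 0 < L (x, y))
    (hh : ∀ x ∈ W, ∀ y, y ≠ 0 → ∀ t : ℝ, 0 < t → L (x, t • y) = t * L (x, y))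
    (hdet : ∀ x ∈ W, ∀ y, y ≠ 0 → (metric L (x, y)).det ≠ 0) {x : Plane} (hx : x ∈ W) {y : Plane}
    (hy : y ≠ 0) : 0 < (metric L (x, y)).det := by
  have hmaps : Set.MapsTo (fun y => ((x, y) : Plane × Plane)) {0}ᶜ
      {p : Plane × Plane | p.1 ∈ W ∧ p.2 ≠ 0} := fun y hy => ⟨hx, hy⟩
  have hcl : ContinuousOn (fun y => ((x, y) : Plane × Plane)) {0}ᶜ := by fun_prop
  obtain ⟨c, hc, hmin, y₀, hy₀, heq⟩ := exists_min_quotient_norm_sq (f := fun y => L (x, y) ^ 2)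
    ((hL.continuousOn.comp hcl hmaps).pow 2) (fun y hy => pow_pos (hpos x hx y hy) 2)
    (fun y hy t ht => by rw [hh x hx y hy t ht]; ring)
  have hp₀ : (x, y₀) ∈ {p : Plane × Plane | p.1 ∈ W ∧ p.2 ≠ 0} := ⟨hx, hy₀⟩
  have hq := metric_pos_of_min hU hL hp₀ (fun y' hy' => hmin y' hy'.2) heq
  have hsymm : metric L (x, y₀) 0 1 = metric L (x, y₀) 1 0 := by
    have h := smoothFunctions.directional_comm hU (0, EuclideanSpace.single 0 1)
      (0, EuclideanSpace.single 1 1) (smoothFunctions.ofContDiffOn (fun q => L q ^ 2) (hL.pow 2))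
    simp only [directional_dy] at h
    exact congrArg (fun t => 1 / 2 * t) (congrFun (congrArg Subtype.val h) ⟨_, hp₀⟩)
  have hdet₀ : 0 < (metric L (x, y₀)).det := by
    have hpos2 : ∀ v : Plane, v ≠ 0 → 0 < ∑ i, ∑ j, metric L (x, y₀) i j * v i * v j := fun v hv =>
      lt_of_lt_of_le (by have := norm_pos_iff.2 hv; positivity) (hq v)
    have h1 := hpos2 (EuclideanSpace.single 0 1) (by simp)
    simp at h1
    -- This vector is orthogonal to the first basis vector, and the form takes the value g₀₀ · det g
    -- on it.
    have h2 := hpos2 !₂[-metric L (x, y₀) 0 1, metric L (x, y₀) 0 0] (fun h => by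
      have := congrArg (fun v : Plane => v 1) h
      simp at this
      exact h1.ne' this)
    simp only [Fin.sum_univ_two, Matrix.cons_val_zero, Matrix.cons_val_one] at h2
    rw [Matrix.det_fin_two]
    refine pos_of_mul_pos_right (a := metric L (x, y₀) 0 0) (h2.trans_le (le_of_eq ?_)) h1.le
    rw [← hsymm]
    ring
  by_contra! hle
  have hcont : ContinuousOn (fun y => (metric L (x, y)).det) {0}ᶜ :=
    (contDiffOn_metric_det hU hL).continuousOn.comp hcl hmaps
  obtain ⟨z, hz, hz0⟩ := isPreconnected_plane_compl_zero.intermediate_value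
    (a := y) (b := y₀) hy hy₀ hcont ⟨hle, hdet₀.le⟩
  exact hdet x hx z hz hz0

namespace IsFinslerOn

variable (D : IsFinslerOn L U)
include D

theorem sum_metric {p : Plane × Plane} (hp : p ∈ U) :
    ∑ i, ∑ j, metric L p i j * p.2 i * p.2 j = L p ^ 2 := by
  have h : ∀ j, p.2 0 * (2 * metric L p 0 j) + p.2 1 * (2 * metric L p 1 j) =
      dy j (fun q => L q ^ 2) p := fun j => by
    rw [← metric_eq, ← metric_eq]
    have h := D.algebra.y_metric j
    rw [algebra_E] at h
    simp only [algebra, directional_dy] at h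
    exact congrFun (congrArg Subtype.val h) ⟨p, hp⟩
  have he := D.euler p hp
  have h2 : ∀ j, dy j (fun q => L q ^ 2) p = 2 * L p * dy j L p := fun j =>
    D.fderiv_sq_apply hp _
  have h0 := h 0
  have h1 := h 1
  rw [h2] at h0 h1
  simp only [Fin.sum_univ_two] at he ⊢
  linear_combination (p.2 0 * h0 + p.2 1 * h1) / 2 + L p * he

end IsFinslerOn

theorem metric_const {W : Set Plane} (D : IsFinslerOn L {p : Plane × Plane | p.1 ∈ W ∧ p.2 ≠ 0})
    (h : ∀ p ∈ {p : Plane × Plane | p.1 ∈ W ∧ p.2 ≠ 0}, ∀ i j k,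
      dy k (fun q => metric L q i j) p = 0)
    {x y y' : Plane} (hx : x ∈ W) (hy : y ≠ 0) (hy' : y' ≠ 0) :
    metric L (x, y) = metric L (x, y') := by
  ext i j
  have hd : ∀ z : Plane, z ≠ 0 → HasFDerivAt (fun z => metric L (x, z) i j) 0 z := fun z hz => by
    have hf := ((contDiffOn_metric D.isOpen D.smooth i j).differentiableAt_of_isOpen D.isOpen
      (p := (x, z)) ⟨hx, hz⟩).hasFDerivAt
    refine (hf.comp z (hasFDerivAt_prodMk_right x z)).congr_fderiv ?_
    ext v
    change fderiv ℝ (fun q => metric L q i j) (x, z) (0, v) = 0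
    rw [fderiv_eq_sum]
    simp [h (x, z) ⟨hx, hz⟩]
  exact isOpen_compl_singleton.is_const_of_fderiv_eq_zero isPreconnected_plane_compl_zero
    (fun z hz => (hd z hz).differentiableAt.differentiableWithinAt) (fun z hz => (hd z hz).fderiv)
    hy hy'

end Finsler

end

/-! ### From charts to the surface. -/

noncomputable section

/-- `ContDiffOn.smul` with a constant vector, for a vector space whose norm has to be found by
unification. -/
theorem ContDiffOn.smul_vector {E V : Type*} [NormedAddCommGroup E] [NormedSpace ℝ E]
    [NormedAddCommGroup V] [NormedSpace ℝ V] {s : Set E} {f : E → ℝ} (hf : ContDiffOn ℝ ∞ f s)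
    (v : V) : ContDiffOn ℝ ∞ (fun x => f x • v) s :=
  hf.smul contDiffOn_const

section Surface

variable {M : Type*} [TopologicalSpace M] [ChartedSpace Plane M]

theorem coordExpr_apply (F : TangentBundle (𝓡 2) M → ℝ) (e : OpenPartialHomeomorph M Plane)
    (x y : Plane) :
    coordExpr F e (x, y) = F ⟨e.symm x, mfderiv 𝓘(ℝ, Plane) (𝓡 2) e.symm x y⟩ := rfl

omit [ChartedSpace Plane M] in
theorem isOpen_slitCoords (e : OpenPartialHomeomorph M Plane) : IsOpen (slitCoords e) :=
  (e.open_target.preimage continuous_fst).inter (isOpen_compl_singleton.preimage continuous_snd)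

variable [IsManifold (𝓡 2) ∞ M]

theorem mdifferentiable_chart_of_mem_atlas {e : OpenPartialHomeomorph M Plane}
    (he : e ∈ atlas Plane M) : e.MDifferentiable (𝓡 2) (𝓡 2) := by
  have : IsManifold (𝓡 2) 1 M := IsManifold.of_le (n := ∞) (by simp)
  exact mdifferentiable_of_mem_atlas he

theorem mfderiv_symm_injective {e : OpenPartialHomeomorph M Plane} (he : e ∈ atlas Plane M)
    {x : Plane} (hx : x ∈ e.target) :
    Function.Injective (mfderiv 𝓘(ℝ, Plane) (𝓡 2) e.symm x) :=
  (mdifferentiable_chart_of_mem_atlas he).symm.mfderiv_injective hx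

namespace FinslerSurface

variable (Φ : FinslerSurface M)

theorem contDiffOn_coordExpr {e : OpenPartialHomeomorph M Plane} (he : e ∈ atlas Plane M) :
    ContDiffOn ℝ ∞ (coordExpr Φ.F e) (slitCoords e) := by
  have : IsManifold (𝓡 2) 1 M := IsManifold.of_le (n := ∞) (by simp)
  have h1 : ContMDiffOn 𝓘(ℝ, Plane) (𝓡 2) ∞ e.symm e.target :=
    contMDiffOn_symm_of_mem_maximalAtlas (IsManifold.subset_maximalAtlas he)
  have h2 := h1.contMDiffOn_tangentMapWithin (m := ∞) (by simp) e.open_target.uniqueMDiffOn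
  have h3 : ContMDiff 𝓘(ℝ, Plane × Plane) (𝓡 2).tangent ∞
      (fun p : Plane × Plane => (⟨p.1, p.2⟩ : TangentBundle 𝓘(ℝ, Plane) Plane)) := by
    intro p₀
    refine Bundle.contMDiffAt_totalSpace.2 ⟨contDiff_fst.contMDiff.contMDiffAt, ?_⟩
    refine (contDiff_snd.contMDiff.contMDiffAt (n := ∞)).congr_of_eventuallyEq
      (Filter.Eventually.of_forall fun p => ?_)
    simp
  have h4 : ContMDiffOn 𝓘(ℝ, Plane × Plane) (𝓡 2).tangent ∞ (fun p : Plane × Plane =>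
      tangentMap 𝓘(ℝ, Plane) (𝓡 2) e.symm ⟨p.1, p.2⟩) (slitCoords e) := by
    refine (h2.comp (h3.contMDiffOn (s := slitCoords e)) fun p hp => hp.1).congr fun p hp => ?_
    exact (tangentMapWithin_eq_tangentMap (e.open_target.uniqueMDiffOn _ hp.1)
      ((mdifferentiable_chart_of_mem_atlas he).mdifferentiableAt_symm hp.1)).symm
  have h5 : ContMDiffOn 𝓘(ℝ, Plane × Plane) 𝓘(ℝ, ℝ) ∞ (coordExpr Φ.F e) (slitCoords e) := by
    refine Φ.smooth.comp h4 fun p hp h0 => hp.2 ?_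
    exact mfderiv_symm_injective he hp.1 (h0.trans (map_zero _).symm)
  exact h5.contDiffOn

theorem isFinslerOn {e : OpenPartialHomeomorph M Plane} (he : e ∈ atlas Plane M) :
    Finsler.IsFinslerOn (coordExpr Φ.F e) (slitCoords e) := by
  have hpos : ∀ x ∈ e.target, ∀ y, y ≠ 0 → 0 < coordExpr Φ.F e (x, y) := fun x hx y hy =>
    Φ.pos _ _ fun h0 => hy (mfderiv_symm_injective he hx (h0.trans (map_zero _).symm))
  have hh : ∀ x ∈ e.target, ∀ y, y ≠ 0 → ∀ t : ℝ, 0 < t →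
      coordExpr Φ.F e (x, t • y) = t * coordExpr Φ.F e (x, y) := fun x _ y _ t ht => by
    refine Eq.trans ?_ (Φ.homogeneous (e.symm x) (mfderiv 𝓘(ℝ, Plane) (𝓡 2) e.symm x y) t ht)
    exact congrArg (fun w => Φ.F ⟨e.symm x, w⟩)
      ((mfderiv 𝓘(ℝ, Plane) (𝓡 2) e.symm x).map_smul t y)
  exact
    { isOpen := isOpen_slitCoords e
      smooth := Φ.contDiffOn_coordExpr he
      pos := fun p hp => hpos p.1 hp.1 p.2 hp.2
      homogeneous := fun p hp => hh p.1 hp.1 p.2 hp.2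
      det_pos := fun p hp => Finsler.metric_det_pos (isOpen_slitCoords e)
        (Φ.contDiffOn_coordExpr he) hpos hh (fun x hx y hy => Φ.nondegenerate e he _ ⟨hx, hy⟩)
        hp.1 hp.2 }

theorem verticalCondition_iff :
    Φ.VerticalCondition Finsler.ricciScalar ↔ Φ.VerticalCondition Finsler.flagCurvature := by
  refine forall₂_congr fun e he => forall₂_congr fun p hp => forall₂_congr fun H hH => ?_
  have D := Φ.isFinslerOn he
  have hne := (pow_pos (D.pos p hp) 2).ne'
  rw [D.fderiv_flagCurvature hp hH.vertical_deriv, Finsler.flagCurvature, ← mul_div_assoc,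
    div_left_inj' hne]

theorem isFirstIntegral_iff :
    Φ.IsFirstIntegral Finsler.ricciScalar ↔ Φ.IsFirstIntegral Finsler.flagCurvature := by
  refine forall₂_congr fun e he => forall₂_congr fun p hp => ?_
  have D := Φ.isFinslerOn he
  rw [D.fderiv_flagCurvature hp (D.fderiv_spray hp), div_eq_zero_iff]
  simp [(D.pos p hp).ne']

/-- The bilinear form `(v, w) ↦ v i * w j` on the plane. -/
def _root_.elementaryBilin (i j : Fin 2) : Plane →L[ℝ] Plane →L[ℝ] ℝ :=
  (EuclideanSpace.proj (𝕜 := ℝ) i).smulRight (EuclideanSpace.proj (𝕜 := ℝ) j)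

/-- The bilinear form on the plane with a given matrix. -/
def _root_.bilinOfMatrix (A : Matrix (Fin 2) (Fin 2) ℝ) : Plane →L[ℝ] Plane →L[ℝ] ℝ :=
  ∑ i, ∑ j, A i j • elementaryBilin i j

omit [ChartedSpace Plane M] [IsManifold (𝓡 2) ∞ M] in
theorem _root_.bilinOfMatrix_apply (A : Matrix (Fin 2) (Fin 2) ℝ) (v w : Plane) :
    bilinOfMatrix A v w = ∑ i, ∑ j, A i j * v i * w j := by
  simp [bilinOfMatrix, elementaryBilin, Fin.sum_univ_two]
  ring

/-- The metric tensor of `Φ` in a chart `e` at a point of `M`, at a fixed reference direction. -/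
def chartForm (e : OpenPartialHomeomorph M Plane) (x : M) : Plane →L[ℝ] Plane →L[ℝ] ℝ :=
  bilinOfMatrix (Finsler.metric (coordExpr Φ.F e) (e x, EuclideanSpace.single 0 1))

/-- The derivative of a chart, as a map to the model plane. -/
def chartDeriv (e : OpenPartialHomeomorph M Plane) (x : M) : Plane →L[ℝ] Plane :=
  mfderiv (𝓡 2) 𝓘(ℝ, Plane) e x

omit [IsManifold (𝓡 2) ∞ M] in
theorem mk_eq_mk {a b : M} (h : a = b) (w : Plane) :
    (⟨a, w⟩ : TangentBundle (𝓡 2) M) = ⟨b, w⟩ := by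
  subst h
  rfl

theorem coordExpr_chartDeriv {e : OpenPartialHomeomorph M Plane} (he : e ∈ atlas Plane M) {x : M}
    (hx : x ∈ e.source) (v : Plane) :
    coordExpr Φ.F e (e x, chartDeriv e x v) = Φ.F ⟨x, v⟩ := by
  have h := (mdifferentiable_chart_of_mem_atlas he).symm_comp_deriv hx
  have h2 : mfderiv 𝓘(ℝ, Plane) (𝓡 2) e.symm (e x) (chartDeriv e x v) = v :=
    congrArg (fun l : Plane →L[ℝ] Plane => l v) h
  rw [coordExpr_apply]
  refine congrArg Φ.F ?_
  exact (mk_eq_mk (e.left_inv hx) _).trans (congrArg (Bundle.TotalSpace.mk x) h2)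

theorem chartDeriv_injective {e : OpenPartialHomeomorph M Plane} (he : e ∈ atlas Plane M) {x : M}
    (hx : x ∈ e.source) : Function.Injective (chartDeriv e x) :=
  (mdifferentiable_chart_of_mem_atlas he).mfderiv_injective hx

/-- The metric tensor in every chart of the atlas does not depend on the direction. -/
def HasVanishingCartanTensor : Prop :=
  ∀ e ∈ atlas Plane M, ∀ p ∈ slitCoords e, ∀ i j k,
    Finsler.dy k (fun q => Finsler.metric (coordExpr Φ.F e) q i j) p = 0

variable {Φ}

/-- Euler's identity gives F² as g(v,v) with g taken at the direction v; constancy of g moves it to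
the reference direction. -/
theorem HasVanishingCartanTensor.sq_eq (h : Φ.HasVanishingCartanTensor)
    {e : OpenPartialHomeomorph M Plane} (he : e ∈ atlas Plane M) {x : M} (hx : x ∈ e.source)
    (v : Plane) : Φ.F ⟨x, v⟩ ^ 2 = Φ.chartForm e x (chartDeriv e x v) (chartDeriv e x v) := by
  by_cases hv : v = 0
  · subst hv
    have : Φ.F ⟨x, (0 : Plane)⟩ = 0 := Φ.zero x
    simp [this]
  have hv' : chartDeriv e x v ≠ 0 := fun h0 =>
    hv (chartDeriv_injective he hx (h0.trans (map_zero _).symm))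
  have D := Φ.isFinslerOn he
  have hp : (e x, chartDeriv e x v) ∈ slitCoords e := ⟨e.map_source hx, hv'⟩
  have hs := D.sum_metric hp
  rw [Φ.coordExpr_chartDeriv he hx] at hs
  rw [← hs, chartForm, bilinOfMatrix_apply, Finsler.metric_const (W := e.target) D (h e he)
    (e.map_source hx) hv' (y' := EuclideanSpace.single 0 1) (by simp)]

variable (Φ) in
/-- The Riemannian metric of a Finsler structure with vanishing Cartan tensor. -/
def riemannianForm (x : M) : Plane →L[ℝ] Plane →L[ℝ] ℝ :=
  (Φ.chartForm (chartAt Plane x) x).bilinearComp (chartDeriv (chartAt Plane x) x)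
    (chartDeriv (chartAt Plane x) x)

theorem chartForm_symm {e : OpenPartialHomeomorph M Plane} (he : e ∈ atlas Plane M) {x : M}
    (hx : x ∈ e.source) (v w : Plane) : Φ.chartForm e x v w = Φ.chartForm e x w v := by
  have hp : (e x, EuclideanSpace.single (0 : Fin 2) (1 : ℝ)) ∈ slitCoords e :=
    ⟨e.map_source hx, by simp⟩
  simp only [chartForm, bilinOfMatrix_apply, Fin.sum_univ_two]
  rw [(Φ.isFinslerOn he).metric_symm _ hp 0 1]
  ring

namespace HasVanishingCartanTensor

variable (h : Φ.HasVanishingCartanTensor)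
include h

/-- Polarization expresses the symmetric form of any chart through F², which does not refer to the
chart. -/
theorem riemannianForm_eq {e : OpenPartialHomeomorph M Plane} (he : e ∈ atlas Plane M) {x : M}
    (hx : x ∈ e.source) (v w : Plane) :
    Φ.riemannianForm x v w = Φ.chartForm e x (chartDeriv e x v) (chartDeriv e x w) := by
  have key : ∀ e ∈ atlas Plane M, x ∈ e.source → 2 * Φ.chartForm e x (chartDeriv e x v)
      (chartDeriv e x w) = Φ.F ⟨x, v + w⟩ ^ 2 - Φ.F ⟨x, v⟩ ^ 2 - Φ.F ⟨x, w⟩ ^ 2 := by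
    intro e he hx
    rw [h.sq_eq he hx v, h.sq_eq he hx w]
    erw [h.sq_eq he hx (v + w)]
    simp only [map_add, add_apply]
    rw [chartForm_symm he hx (chartDeriv e x w) (chartDeriv e x v)]
    ring
  have h1 := key e he hx
  have h2 := key _ (chart_mem_atlas Plane x) (mem_chart_source Plane x)
  rw [← h1] at h2
  exact mul_left_cancel₀ two_ne_zero h2

theorem sq_eq_riemannianForm (x : M) (v : Plane) : Φ.F ⟨x, v⟩ ^ 2 = Φ.riemannianForm x v v :=
  h.sq_eq (chart_mem_atlas Plane x) (mem_chart_source Plane x) v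

omit h in
theorem contMDiffOn_chartForm {e : OpenPartialHomeomorph M Plane} (he : e ∈ atlas Plane M) :
    ContMDiffOn (𝓡 2) 𝓘(ℝ, Plane →L[ℝ] Plane →L[ℝ] ℝ) ∞ (Φ.chartForm e) e.source := by
  have D := Φ.isFinslerOn he
  have h1 : ContDiffOn ℝ ∞ (fun x : Plane => bilinOfMatrix
      (Finsler.metric (coordExpr Φ.F e) (x, EuclideanSpace.single 0 1))) e.target := by
    refine ContDiffOn.sum fun i _ => ContDiffOn.sum fun j _ => ?_
    have hm : ContDiffOn ℝ ∞ (fun x : Plane =>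
        Finsler.metric (coordExpr Φ.F e) (x, EuclideanSpace.single 0 1) i j) e.target :=
      (Finsler.contDiffOn_metric D.isOpen D.smooth i j).comp
        (contDiff_id.prodMk contDiff_const).contDiffOn fun x hx => ⟨hx, by simp⟩
    exact hm.smul_vector (elementaryBilin i j)
  exact h1.contMDiffOn.comp
    (contMDiffOn_of_mem_maximalAtlas (IsManifold.subset_maximalAtlas he)) fun x hx => e.map_source hx

theorem isRiemannian : Φ.IsRiemannian := by
  have : IsManifold (𝓡 2) 1 M := IsManifold.of_le (n := ∞) (by simp)
  refine ⟨{ inner := fun x => Φ.riemannianForm x, symm := ?_, pos := ?_, isVonNBounded := ?_,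
            contMDiff := ?_ }, fun x v => h.sq_eq_riemannianForm x v⟩
  · exact fun x v w => chartForm_symm (chart_mem_atlas Plane x) (mem_chart_source Plane x) _ _
  · intro x v hv
    exact (pow_pos (Φ.pos x v hv) 2).trans_eq (h.sq_eq_riemannianForm x v)
  · intro x
    change Bornology.IsVonNBounded ℝ {v : Plane | Φ.riemannianForm x v v < 1}
    -- The form is bounded below by c‖v‖² with c > 0, so its unit ball has radius at most √(c⁻¹).
    obtain ⟨c, hc, hmin, -⟩ := exists_min_quotient_norm_sq
      (f := fun v => Φ.riemannianForm x v v) (by fun_prop)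
      (fun v hv => (pow_pos (Φ.pos x v hv) 2).trans_eq (h.sq_eq_riemannianForm x v))
      (fun v _ t _ => by simp; ring)
    rw [NormedSpace.isVonNBounded_iff, isBounded_iff_forall_norm_le]
    refine ⟨√c⁻¹, fun v hv => Real.le_sqrt_of_sq_le ?_⟩
    by_cases h0 : v = 0
    · simp [h0, hc.le]
    have := (hmin v h0).trans_lt hv
    rw [← one_div, le_div_iff₀ hc]
    linarith
  · intro x₀
    rw [contMDiffAt_hom_bundle]
    refine ⟨contMDiffAt_id, ?_⟩
    have he := chart_mem_atlas Plane x₀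
    have hx₀ := (chartAt Plane x₀).open_source.mem_nhds (mem_chart_source Plane x₀)
    refine ((contMDiffOn_chartForm (Φ := Φ) he).contMDiffAt hx₀).congr_of_eventuallyEq ?_
    filter_upwards [hx₀] with x hx
    ext1 v
    ext1 w
    have hb : x ∈ (trivializationAt Plane (TangentSpace (𝓡 2)) x₀).baseSet := by simpa using hx
    -- The tangent trivialization at x₀ is the derivative of the chart at x₀. In it the form,
    -- defined through a chart varying with x, becomes the form of this one fixed chart, which is
    -- smooth.
    have hd : ∀ v : Plane, chartDeriv (chartAt Plane x₀) x
        ((trivializationAt Plane (TangentSpace (𝓡 2)) x₀).symm x v) = v := fun v => by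
      have h1 := (trivializationAt Plane (TangentSpace (𝓡 2)) x₀).continuousLinearMapAt_symmL (R := ℝ) hb v
      rw [TangentBundle.continuousLinearMapAt_trivializationAt hx,
        Bundle.Trivialization.symmL_apply _ hb] at h1
      have hext : (extChartAt (𝓡 2) x₀ : M → Plane) = chartAt Plane x₀ := rfl
      rw [hext] at h1
      exact h1
    refine (inCoordinates_apply_eq₂ (F₃ := ℝ) (E₃ := Bundle.Trivial M ℝ) (v := v) (w := w)
      hb hb (Set.mem_univ _)).trans ?_
    simp only [Bundle.Trivial.fiberBundle_trivializationAt',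
      Bundle.Trivial.linearMapAt_trivialization, LinearMap.id_coe, id_eq]
    refine (h.riemannianForm_eq he hx _ _).trans ?_
    rw [hd, hd]

end HasVanishingCartanTensor

theorem isRiemannian_of_ricci (hΦ : Φ.IsNonflat) (hV : Φ.VerticalCondition Finsler.ricciScalar)
    (hS : Φ.IsFirstIntegral Finsler.ricciScalar) : Φ.IsRiemannian :=
  HasVanishingCartanTensor.isRiemannian fun e he _ hp =>
    (Φ.isFinslerOn he).dy_metric_eq_zero (hΦ e he) (hS e he) (hV e he) hp

end FinslerSurface

end Surface

end

theorem mainTheorem1 {M : Type*} [TopologicalSpace M] [ChartedSpace Plane M]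
    [IsManifold (𝓡 2) ∞ M] (Φ : FinslerSurface M) (hΦ : Φ.IsNonflat) :
    (Φ.VerticalCondition Finsler.ricciScalar ↔ Φ.VerticalCondition Finsler.flagCurvature) ∧
    (Φ.IsFirstIntegral Finsler.ricciScalar ↔ Φ.IsFirstIntegral Finsler.flagCurvature) ∧
    (Φ.VerticalCondition Finsler.ricciScalar → Φ.IsFirstIntegral Finsler.ricciScalar →
      Φ.IsRiemannian) :=
  ⟨Φ.verticalCondition_iff, Φ.isFirstIntegral_iff, Φ.isRiemannian_of_ricci hΦ⟩
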